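/- Let $K$ be plain Kolmogorov complexity of binary strings with respect to a fixed universal machine $U$ (so for every partial computable $M$ on binary strings, $K_U\le K_M+O(1)$). Write $x(1:n)$ for the initial segment of length $n$ of an infinite binary sequence $x$, and $\log=\log_2$. For a constant $c$, call $x,y\in\{0,1\}^\infty$ independent with constant $c$ if there is a $d$ (which may depend on $x,y$) such that for all $n,m\ge 1$ $$K(x(1:n)\,y(1:m))\ \ge\ K(x(1:n))+K(y(1:m))-c(\log n+\log m)-d .$$ A truth-table reduction $f:\{0,1\}^\infty\times\{0,1\}^\infty\to\{0,1\}^\infty$ is a map computed by a two-oracle machine that halts on every input $n$ and for all oracles $x,y$, its output being the $n$-th bit of $f(x,y)$. **Theorem.** For every $\delta>0$ and every $c$ there exist a constant $C$ and a truth-table reduction $f$ with the following property. If $x,y\in\{0,1\}^\infty$ are independent with constant $c$ and $K(x(1:n))>C\log n$ and $K(y(1:n))>C\log n$ for all sufficiently large $n$, then $z=f(x,y)$ satisfies $K(z(1:n))>(1-\delta)n$ for infinitely many $n$. Furthermore, there is an infinite computable set $S\subseteq\mathbb N$ such that $K(z(1:n))>(1-\delta)n$ for every $n\in S$. -/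

import Mathlib

open Filter

/-- A machine: a partial function on binary strings, meant to be partial computable. -/
abbrev Machine := List Bool →. List Bool

/-- Plain Kolmogorov complexity `K_M(x) = min {|p| : M(p) = x}`, equal to `⊤` if `M` never
outputs `x`. -/
noncomputable def machineComplexity (M : Machine) (x : List Bool) : ℕ∞ :=
  ⨅ (p : List Bool) (_ : x ∈ M p), (p.length : ℕ∞)

/-- `U` is a universal machine: it is partial computable, and for every partial computable `M`
there is a constant `c` with `K_U(x) ≤ K_M(x) + c` for all strings `x`. -/
def IsUniversalMachine (U : Machine) : Prop :=
  Partrec U ∧ ∀ M : Machine, Partrec M →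
    ∃ c : ℕ, ∀ x : List Bool, machineComplexity U x ≤ machineComplexity M x + c

/-- `K(x)` with respect to `U`, as a natural number. For universal `U` the value
`machineComplexity U x` is finite for every `x`, so nothing is lost by `toNat`. -/
noncomputable def plainK (U : Machine) (x : List Bool) : ℕ :=
  (machineComplexity U x).toNat

/-- Infinite binary sequences; the `n`-th bit, counted from one, is the value at `n - 1`. -/
abbrev BinSeq := ℕ → Bool

/-- The initial segment `x(1:n)`, which has length `n`. -/
def initSeg (x : BinSeq) (n : ℕ) : List Bool := (List.range n).map x

/-- The sequences `x` and `y` are independent, with leading constant `c` in the logarithmic error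
term: `K(x(1:n) y(1:m)) ≥ K(x(1:n)) + K(y(1:m)) - c (log n + log m) - O(1)` for all `n` and `m`.
The additive constant may depend on `x` and `y`. -/
def IndependentWith (U : Machine) (c : ℝ) (x y : BinSeq) : Prop :=
  ∃ d : ℝ, ∀ n m : ℕ, 1 ≤ n → 1 ≤ m →
    (plainK U (initSeg x n) : ℝ) + (plainK U (initSeg y m) : ℝ)
        - c * (Real.logb 2 n + Real.logb 2 m) - d
      ≤ (plainK U (initSeg x n ++ initSeg y m) : ℝ)

/-- The partial functions `ℕ →. ℕ` computed by machines with two oracles, uniformly in the oracle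
sequences. The clauses are those of `Nat.Partrec`, together with the two query operations
`n`-th bit of the first oracle and `n`-th bit of the second oracle. -/
inductive OracleComputable : (BinSeq → BinSeq → ℕ →. ℕ) → Prop
  | zero : OracleComputable fun _ _ _ => Part.some 0
  | succ : OracleComputable fun _ _ n => Part.some (n + 1)
  | left : OracleComputable fun _ _ n => Part.some n.unpair.1
  | right : OracleComputable fun _ _ n => Part.some n.unpair.2
  | queryFirst : OracleComputable fun x _ n => Part.some (x n).toNat
  | querySecond : OracleComputable fun _ y n => Part.some (y n).toNat
  | pair {f g : BinSeq → BinSeq → ℕ →. ℕ} (hf : OracleComputable f) (hg : OracleComputable g) :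
      OracleComputable fun x y n => Nat.pair <$> f x y n <*> g x y n
  | comp {f g : BinSeq → BinSeq → ℕ →. ℕ} (hf : OracleComputable f) (hg : OracleComputable g) :
      OracleComputable fun x y n => g x y n >>= f x y
  | prec {f g : BinSeq → BinSeq → ℕ →. ℕ} (hf : OracleComputable f) (hg : OracleComputable g) :
      OracleComputable fun x y => Nat.unpaired fun a n =>
        n.rec (f x y a) fun k IH => do
          let i ← IH
          g x y (Nat.pair a (Nat.pair k i))
  | rfind {f : BinSeq → BinSeq → ℕ →. ℕ} (hf : OracleComputable f) :
      OracleComputable fun x y a =>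
        Nat.rfind fun n => (fun m => decide (m = 0)) <$> f x y (Nat.pair a n)

/-- A truth-table reduction: some two-oracle machine, on every input `n` and with all oracles
`x` and `y`, halts and outputs the bit `f x y n`. -/
def IsTruthTableReduction (f : BinSeq → BinSeq → BinSeq) : Prop :=
  OracleComputable fun x y n => Part.some (f x y n).toNat

/-- The number whose binary digits, least significant first, are the bits of the list. -/
def lnum (l : List Bool) : ℕ := l.foldr (fun b a => 2 * a + b.toNat) 0

@[simp] theorem lnum_nil : lnum [] = 0 := rfl

@[simp] theorem lnum_cons (b : Bool) (l : List Bool) : lnum (b :: l) = 2 * lnum l + b.toNat := rfl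

theorem lnum_lt (l : List Bool) : lnum l < 2 ^ l.length := by
  induction l with
  | nil => simp
  | cons b l ih =>
    have := Bool.toNat_le b
    simp only [lnum_cons, List.length_cons, pow_succ]
    omega

theorem lnum_append (l l' : List Bool) : lnum (l ++ l') = lnum l + 2 ^ l.length * lnum l' := by
  induction l with
  | nil => simp
  | cons b l ih => simp only [List.cons_append, lnum_cons, ih, List.length_cons, pow_succ]; ring

theorem testBit_lnum (l : List Bool) (j : ℕ) : (lnum l).testBit j = l.getD j false := by
  induction l generalizing j with
  | nil => simp
  | cons b l ih =>
    cases j with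
    | zero => cases b <;> simp [Nat.testBit_zero, Nat.add_mod]
    | succ j =>
      rw [lnum_cons, Nat.testBit_succ]
      have : (2 * lnum l + b.toNat) / 2 = lnum l := by
        have := Bool.toNat_le b
        omega
      rw [this, ih]; simp

theorem lnum_injOn {l l' : List Bool} (h : l.length = l'.length) (e : lnum l = lnum l') :
    l = l' := by
  induction l generalizing l' with
  | nil => simpa [eq_comm] using h
  | cons b l ih =>
    cases l' with
    | nil => simp at h
    | cons b' l' =>
      simp only [lnum_cons] at e
      have : b.toNat = b'.toNat ∧ lnum l = lnum l' := by
        have := Bool.toNat_le b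
        have := Bool.toNat_le b'
        omega
      have hb : b = b' := by revert this; cases b <;> cases b' <;> simp
      rw [hb, ih (by simpa using h) this.2]

@[simp] theorem length_initSeg (x : BinSeq) (n : ℕ) : (initSeg x n).length = n := by
  simp [initSeg]

theorem initSeg_succ (x : BinSeq) (n : ℕ) : initSeg x (n + 1) = initSeg x n ++ [x n] := by
  simp [initSeg, List.range_succ]

theorem testBit_lnum_initSeg (x : BinSeq) (n j : ℕ) :
    (lnum (initSeg x n)).testBit j = (decide (j < n) && x j) := by
  rw [testBit_lnum]
  by_cases h : j < n <;> simp [initSeg, List.getD, h]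

theorem lnum_initSeg_lt (x : BinSeq) (n : ℕ) : lnum (initSeg x n) < 2 ^ n := by
  simpa using lnum_lt (initSeg x n)

theorem lnum_initSeg_testBit {v n : ℕ} (h : v < 2 ^ n) :
    lnum (initSeg (fun j => v.testBit j) n) = v := by
  refine Nat.eq_of_testBit_eq fun j => ?_
  rw [testBit_lnum_initSeg]
  by_cases hj : j < n
  · simp [hj]
  · have : v < 2 ^ j := h.trans_le (Nat.pow_le_pow_right (by norm_num) (not_lt.1 hj))
    simp [hj, Nat.testBit_lt_two_pow this]

/-- A colouring of the `N × N` grid by numbers is balanced if every colour set of size `A` occupies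
at most `T` cells in every combinatorial `K × K` rectangle. -/
def BalancedColouring (N M K A T : ℕ) (E : ℕ → ℕ → ℕ) : Prop :=
  ∀ s ⊆ Finset.range N, ∀ t ⊆ Finset.range N, ∀ a ⊆ Finset.range M,
    s.card = K → t.card = K → a.card = A →
      ∑ x ∈ s, ∑ y ∈ t, (if E x y ∈ a then 1 else 0) ≤ T

theorem Finset.sum_le_mul_of_card_le {X : Finset ℕ} {w : ℕ → ℕ} {K T : ℕ}
    (hK : K ≤ X.card) (h : ∀ s ⊆ X, s.card = K → ∑ x ∈ s, w x ≤ T) (r : ℕ) :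
    ∀ b ⊆ X, b.card ≤ K * r → ∑ x ∈ b, w x ≤ r * T := by
  induction r with
  | zero =>
    intro b _ hb
    have : b = ∅ := by simpa using hb
    simp [this]
  | succ r ih =>
    intro b hbX hb
    by_cases hc : b.card ≤ K
    · obtain ⟨s, hbs, hsX, hs⟩ := Finset.exists_subsuperset_card_eq hbX hc hK
      calc ∑ x ∈ b, w x ≤ ∑ x ∈ s, w x := Finset.sum_le_sum_of_subset hbs
        _ ≤ T := h s hsX hs
        _ ≤ (r + 1) * T := Nat.le_mul_of_pos_left _ (by omega)
    · obtain ⟨s, hsb, hs⟩ := Finset.exists_subset_card_eq (le_of_not_ge hc)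
      rw [← Finset.sum_sdiff hsb, add_mul, one_mul]
      refine add_le_add (ih _ (Finset.sdiff_subset.trans hbX) ?_) (h s (hsb.trans hbX) hs)
      rw [Finset.card_sdiff_of_subset hsb, hs]
      rw [mul_add] at hb
      omega

theorem BalancedColouring.sum_le {N M K A T : ℕ} {E : ℕ → ℕ → ℕ} (h : BalancedColouring N M K A T E)
    (hK : K ≤ N) (hA : A ≤ M) {r₁ r₂ : ℕ} {s t a : Finset ℕ} (hs : s ⊆ Finset.range N)
    (ht : t ⊆ Finset.range N) (ha : a ⊆ Finset.range M) (hsK : s.card ≤ K * r₁)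
    (htK : t.card ≤ K * r₂) (haA : a.card ≤ A) :
    ∑ x ∈ s, ∑ y ∈ t, (if E x y ∈ a then 1 else 0) ≤ r₁ * (r₂ * T) := by
  obtain ⟨a', haa', ha'M, ha'⟩ :=
    Finset.exists_subsuperset_card_eq ha haA (by simpa using hA)
  have hmono : ∀ s' t' : Finset ℕ, ∑ x ∈ s', ∑ y ∈ t', (if E x y ∈ a then 1 else 0)
      ≤ ∑ x ∈ s', ∑ y ∈ t', (if E x y ∈ a' then 1 else 0) := by
    intro s' t'
    refine Finset.sum_le_sum fun x _ => Finset.sum_le_sum fun y _ => ?_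
    by_cases hxy : E x y ∈ a
    · simp [hxy, haa' hxy]
    · simp [hxy]
  refine (hmono s t).trans ?_
  refine Finset.sum_le_mul_of_card_le (X := Finset.range N) (by simpa using hK) ?_ r₁ s hs hsK
  intro s' hs' hs'K
  rw [Finset.sum_comm]
  refine Finset.sum_le_mul_of_card_le (X := Finset.range N) (by simpa using hK) ?_ r₂ t ht htK
  intro t' ht' ht'K
  rw [Finset.sum_comm]
  exact h s' hs' t' ht' a' ha'M hs'K ht'K ha'

theorem succ_pow_self_le (G : ℕ) : (G + 1) ^ G ≤ 4 * G ^ G := by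
  rcases Nat.eq_zero_or_pos G with rfl | hG
  · simp
  have hG' : (0 : ℝ) < G := by exact_mod_cast hG
  have h1 : ((G : ℝ) + 1) = G * (1 / G + 1) := by field_simp; ring
  have h2 : ((1 : ℝ) / G + 1) ^ G ≤ 4 := by
    calc ((1 : ℝ) / G + 1) ^ G ≤ (Real.exp (1 / G)) ^ G :=
          pow_le_pow_left₀ (by positivity) (Real.add_one_le_exp _) _
      _ = Real.exp 1 := by rw [← Real.exp_nat_mul]; congr 1; field_simp
      _ ≤ 4 := by have := Real.exp_one_lt_d9; linarith
  have h3 : ((G : ℝ) + 1) ^ G ≤ 4 * (G : ℝ) ^ G := by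
    rw [h1, mul_pow, mul_comm]
    exact mul_le_mul_of_nonneg_right h2 (by positivity)
  exact_mod_cast h3

theorem sum_two_pow_card_filter {ι γ : Type*} [Fintype ι] [DecidableEq ι] [Fintype γ]
    [DecidableEq γ] (S : Finset ι) (a : Finset γ) :
    ∑ E : ι → γ, 2 ^ (S.filter fun i => E i ∈ a).card
      = (Fintype.card γ + a.card) ^ S.card * Fintype.card γ ^ (Fintype.card ι - S.card) := by
  have h1 : ∀ E : ι → γ, 2 ^ (S.filter fun i => E i ∈ a).card
      = ∏ i, (if i ∈ S ∧ E i ∈ a then 2 else 1) := by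
    intro E
    rw [Finset.prod_ite, Finset.prod_const, Finset.prod_const_one, mul_one]
    congr 2
    ext i; simp
  have h2 : ∀ i, ∑ c : γ, (if i ∈ S ∧ c ∈ a then 2 else 1)
      = if i ∈ S then Fintype.card γ + a.card else Fintype.card γ := by
    intro i
    by_cases hi : i ∈ S
    · simp only [hi, true_and, if_true]
      have : ∀ c : γ, (if c ∈ a then 2 else 1) = 1 + (if c ∈ a then 1 else 0) := by
        intro c; split <;> rfl
      simp [this, Finset.sum_add_distrib]
    · simp [hi]
  simp_rw [h1]
  rw [← Fintype.prod_sum (fun i c => if i ∈ S ∧ c ∈ a then 2 else 1)]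
  simp_rw [h2]
  rw [Finset.prod_ite, Finset.prod_const, Finset.prod_const]
  congr 2
  · congr 1; ext i; simp
  · rw [← Finset.card_compl]; congr 1; ext i; simp

theorem card_filter_lt_mul_le {ι γ : Type*} [Fintype ι] [DecidableEq ι] [Fintype γ]
    [DecidableEq γ] (S : Finset ι) (a : Finset γ) {G j : ℕ} (hS : S.card = G * j)
    (hγ : Fintype.card γ = a.card * G) :
    (Finset.univ.filter fun E : ι → γ => 4 * j < (S.filter fun i => E i ∈ a).card).card * 4 ^ j
      ≤ Fintype.card γ ^ Fintype.card ι := by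
  set bad := Finset.univ.filter fun E : ι → γ => 4 * j < (S.filter fun i => E i ∈ a).card
  have h1 : bad.card * 2 ^ (4 * j) ≤ ∑ E : ι → γ, 2 ^ (S.filter fun i => E i ∈ a).card := by
    calc bad.card * 2 ^ (4 * j) = ∑ _E ∈ bad, 2 ^ (4 * j) := by simp
      _ ≤ ∑ E ∈ bad, 2 ^ (S.filter fun i => E i ∈ a).card := by
          refine Finset.sum_le_sum fun E hE => Nat.pow_le_pow_right (by norm_num) ?_
          exact (Finset.mem_filter.1 hE).2.le
      _ ≤ _ := Finset.sum_le_sum_of_subset (Finset.subset_univ _)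
  rw [sum_two_pow_card_filter] at h1
  have h2 : (Fintype.card γ + a.card) ^ S.card ≤ 4 ^ j * Fintype.card γ ^ S.card := by
    have : Fintype.card γ + a.card = a.card * (G + 1) := by rw [hγ]; ring
    rw [this, hγ, mul_pow, mul_pow, hS, mul_left_comm]
    refine Nat.mul_le_mul_left _ ?_
    rw [pow_mul, pow_mul, ← mul_pow]
    exact Nat.pow_le_pow_left (succ_pow_self_le G) j
  have h3 : bad.card * 2 ^ (4 * j) ≤ 4 ^ j * Fintype.card γ ^ Fintype.card ι := by
    refine h1.trans ((Nat.mul_le_mul_right _ h2).trans (le_of_eq ?_))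
    rw [mul_assoc, ← pow_add, Nat.add_sub_cancel' (Finset.card_le_univ S)]
  have h4 : 2 ^ (4 * j) = 4 ^ j * 4 ^ j := by
    rw [← mul_pow, pow_mul]; norm_num
  rw [h4] at h3
  refine Nat.le_of_mul_le_mul_left ?_ (show 0 < 4 ^ j by positivity)
  linarith

theorem exists_balanced {n M K A G j : ℕ} (hM : M = A * G) (hM0 : 0 < M) (hK : K * K = G * j)
    (hj : 2 * n * K + M < 2 * j) :
    ∃ E : ℕ → ℕ → ℕ, (∀ x y, E x y < M) ∧ BalancedColouring (2 ^ n) M K A (4 * j) E := by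
  classical
  set N := 2 ^ n with hN
  let P := ((Finset.powersetCard K (Finset.univ : Finset (Fin N))) ×ˢ
    (Finset.powersetCard K (Finset.univ : Finset (Fin N)))) ×ˢ
    (Finset.powersetCard A (Finset.univ : Finset (Fin M)))
  let bad : (Finset (Fin N) × Finset (Fin N)) × Finset (Fin M) → Finset (Fin N × Fin N → Fin M) :=
    fun p => Finset.univ.filter fun E =>
      4 * j < ((p.1.1 ×ˢ p.1.2).filter fun i => E i ∈ p.2).card
  have hbad : ∀ p ∈ P, (bad p).card * 4 ^ j ≤ M ^ (N * N) := by
    rintro ⟨⟨s, t⟩, a⟩ hp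
    simp only [P, Finset.mem_product, Finset.mem_powersetCard_univ] at hp
    have := card_filter_lt_mul_le (s ×ˢ t) a (G := G) (j := j)
      (by rw [Finset.card_product, hp.1.1, hp.1.2, hK]) (by rw [hp.2, Fintype.card_fin, hM])
    simpa [Fintype.card_prod] using this
  have hP : P.card < 4 ^ j := by
    have h1 : P.card ≤ (N ^ K * N ^ K) * 2 ^ M := by
      simp only [P, Finset.card_product, Finset.card_powersetCard, Finset.card_univ,
        Fintype.card_fin]
      gcongr
      · exact Nat.choose_le_pow N K
      · exact Nat.choose_le_pow N K
      · exact Nat.choose_le_two_pow M A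
    refine h1.trans_lt ?_
    have : (4 : ℕ) ^ j = 2 ^ (2 * j) := by rw [pow_mul]; norm_num
    rw [this, hN, ← pow_mul, ← pow_add, ← pow_add]
    exact Nat.pow_lt_pow_right (by norm_num) (by linarith)
  have hM' : 0 < M ^ (N * N) := pow_pos hM0 _
  have hlt : (P.biUnion bad).card < (Finset.univ : Finset (Fin N × Fin N → Fin M)).card := by
    have h1 : (P.biUnion bad).card * 4 ^ j ≤ P.card * M ^ (N * N) := by
      calc (P.biUnion bad).card * 4 ^ j ≤ (∑ p ∈ P, (bad p).card) * 4 ^ j :=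
            Nat.mul_le_mul_right _ Finset.card_biUnion_le
        _ = ∑ p ∈ P, (bad p).card * 4 ^ j := Finset.sum_mul _ _ _
        _ ≤ ∑ _p ∈ P, M ^ (N * N) := Finset.sum_le_sum hbad
        _ = _ := by simp
    have h2 : P.card * M ^ (N * N) < M ^ (N * N) * 4 ^ j := by
      rw [mul_comm]; exact Nat.mul_lt_mul_of_pos_left hP hM'
    have h3 := Nat.lt_of_mul_lt_mul_right (h1.trans_lt h2)
    simpa [Finset.card_univ] using h3
  obtain ⟨E, -, hE⟩ := Finset.exists_mem_notMem_of_card_lt_card hlt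
  refine ⟨fun x y => if h : x < N ∧ y < N then E (⟨x, h.1⟩, ⟨y, h.2⟩) else 0, ?_, ?_⟩
  · intro x y
    dsimp only
    split
    · exact Fin.is_lt _
    · exact hM0
  · intro s hs t ht a ha hsK htK haA
    by_contra hcon
    refine hE (Finset.mem_biUnion.2 ⟨((s.attachFin fun x hx => Finset.mem_range.1 (hs hx),
      t.attachFin fun x hx => Finset.mem_range.1 (ht hx)),
      a.attachFin fun x hx => Finset.mem_range.1 (ha hx)), ?_, ?_⟩)
    · simp [P, Finset.mem_product, hsK, htK, haA]
    · simp only [bad, Finset.mem_filter, Finset.mem_univ, true_and]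
      refine (not_le.1 hcon).trans_le (le_of_eq ?_)
      rw [← Finset.sum_product', ← Finset.card_filter]
      symm
      refine Finset.card_bij (fun p _ => ((p.1 : ℕ), (p.2 : ℕ))) ?_ ?_ ?_
      · rintro ⟨x, y⟩ h
        simp only [Finset.mem_filter, Finset.mem_product, Finset.mem_attachFin] at h ⊢
        simpa using h
      · rintro ⟨x, y⟩ _ ⟨x', y'⟩ _ h
        simpa [Fin.ext_iff] using h
      · rintro ⟨x, y⟩ h
        simp only [Finset.mem_filter, Finset.mem_product] at h
        have hx := Finset.mem_range.1 (hs h.1.1)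
        have hy := Finset.mem_range.1 (ht h.1.2)
        refine ⟨(⟨x, hx⟩, ⟨y, hy⟩), ?_, rfl⟩
        simp only [Finset.mem_filter, Finset.mem_product, Finset.mem_attachFin]
        have h2 := h.2
        rw [dif_pos ⟨hx, hy⟩] at h2
        exact ⟨h.1, h2⟩

theorem PrimrecPred.forall_lt_of {α : Type*} [Primcodable α] {R : α → ℕ → Prop} {f : α → ℕ}
    (hR : PrimrecPred fun q : α × ℕ => R q.1 q.2) (hf : Primrec f) :
    PrimrecPred fun a => ∀ x < f a, R a x :=
  ((PrimrecRel.forall_mem_list (R := fun (x : ℕ) (a : α) => R a x) (PrimrecPred.primrecRel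
    (hR.comp (Primrec.pair Primrec.snd Primrec.fst)))).comp
      (Primrec.list_range.comp hf) Primrec.id).of_eq fun a => by simp

theorem PrimrecPred.forall_lt₃ {α : Type*} [Primcodable α] {R : α → ℕ → ℕ → ℕ → Prop}
    {f g h : α → ℕ}
    (hR : PrimrecPred fun q : ((α × ℕ) × ℕ) × ℕ => R q.1.1.1 q.1.1.2 q.1.2 q.2)
    (hf : Primrec f) (hg : Primrec g) (hh : Primrec h) :
    PrimrecPred fun a => ∀ x < f a, ∀ y < g a, ∀ z < h a, R a x y z := by
  have h1 := PrimrecPred.forall_lt_of (R := fun (q : (α × ℕ) × ℕ) z => R q.1.1 q.1.2 q.2 z)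
    hR (hh.comp (.comp .fst .fst))
  have h2 := PrimrecPred.forall_lt_of (R := fun (q : α × ℕ) y => ∀ z < h q.1, R q.1 q.2 y z)
    h1 (hg.comp .fst)
  exact PrimrecPred.forall_lt_of (R := fun q x => ∀ y < g q, ∀ z < h q, R q x y z) h2 hf

theorem PrimrecPred.exists_lt_of {α : Type*} [Primcodable α] {R : α → ℕ → Prop} {f : α → ℕ}
    (hR : PrimrecPred fun q : α × ℕ => R q.1 q.2) (hf : Primrec f) :
    PrimrecPred fun a => ∃ x < f a, R a x :=
  ((PrimrecRel.exists_mem_list (R := fun (x : ℕ) (a : α) => R a x) (PrimrecPred.primrecRel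
    (hR.comp (Primrec.pair Primrec.snd Primrec.fst)))).comp
      (Primrec.list_range.comp hf) Primrec.id).of_eq fun a => by simp

theorem PrimrecPred.imp {α : Type*} [Primcodable α] {p q : α → Prop} (hp : PrimrecPred p)
    (hq : PrimrecPred q) : PrimrecPred fun a => p a → q a :=
  (hp.not.or hq).of_eq fun _ => imp_iff_not_or.symm

theorem Primrec.sum_range {α : Type*} [Primcodable α] {f : α → ℕ → ℕ} {g : α → ℕ}
    (hf : Primrec₂ f) (hg : Primrec g) : Primrec fun a => ∑ i ∈ Finset.range (g a), f a i := by
  refine (Primrec.nat_rec' (f := g) (g := fun _ => 0) (h := fun a p => p.2 + f a p.1) hg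
    (Primrec.const 0) ?_).of_eq fun a => ?_
  · exact Primrec.nat_add.comp (Primrec.snd.comp Primrec.snd)
      (hf.comp Primrec.fst (Primrec.fst.comp Primrec.snd))
  · induction g a with
    | zero => rfl
    | succ n ih => rw [Finset.sum_range_succ, ← ih]

theorem Primrec.nat_pow : Primrec₂ ((· ^ ·) : ℕ → ℕ → ℕ) :=
  Primrec₂.unpaired'.1 Nat.Primrec.pow

theorem Primrec.nat_testBit : Primrec₂ Nat.testBit := by
  have : PrimrecRel fun a i : ℕ => a / 2 ^ i % 2 = 1 :=
    Primrec.eq.comp (Primrec.nat_mod.comp (Primrec.nat_div.comp Primrec.fst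
      (Primrec.nat_pow.comp (Primrec.const 2) Primrec.snd)) (Primrec.const 2)) (Primrec.const 1)
  exact this.decide.of_eq fun a i => Nat.testBit_eq_decide_div_mod_eq.symm

theorem Primrec.nat_beta : Primrec₂ Nat.beta :=
  Primrec.nat_mod.comp (Primrec.fst.comp (Primrec.unpair.comp Primrec.fst))
    (Primrec.succ.comp (Primrec.nat_mul.comp (Primrec.succ.comp Primrec.snd)
      (Primrec.snd.comp (Primrec.unpair.comp Primrec.fst))))

theorem PrimrecPred.testBit {α : Type*} [Primcodable α] {f g : α → ℕ} (hf : Primrec f)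
    (hg : Primrec g) : PrimrecPred fun a => (f a).testBit (g a) = true :=
  Primrec.eq.comp (Primrec.nat_testBit.comp hf hg) (Primrec.const true)

/-- The colouring of the `N × N` grid with `M` colours that has code `e`. -/
def codeColouring (N M e x y : ℕ) : ℕ := Nat.beta e (x * N + y) % M

theorem codeColouring_lt {N M e x y : ℕ} (hM : 0 < M) : codeColouring N M e x y < M :=
  Nat.mod_lt _ hM

theorem exists_codeColouring_eq (N M : ℕ) (E : ℕ → ℕ → ℕ) (hE : ∀ x y, E x y < M) :
    ∃ e, ∀ x < N, ∀ y < N, codeColouring N M e x y = E x y := by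
  refine ⟨Nat.unbeta ((List.range (N * N)).map fun i => E (i / N) (i % N)), fun x hx y hy => ?_⟩
  have hN : 0 < N := by omega
  have hi : x * N + y < N * N := by nlinarith
  have := Nat.beta_unbeta_coe ((List.range (N * N)).map fun i => E (i / N) (i % N))
    ⟨x * N + y, by simpa using hi⟩
  simp only at this
  rw [codeColouring, this]
  have h1 : (x * N + y) / N = x := by
    rw [mul_comm, Nat.mul_add_div hN, Nat.div_eq_of_lt hy, add_zero]
  have h2 : (x * N + y) % N = y := by
    rw [mul_comm, Nat.mul_add_mod, Nat.mod_eq_of_lt hy]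
  simp [h1, h2, Nat.mod_eq_of_lt (hE x y)]

theorem BalancedColouring.congr {N M K A T : ℕ} {E E' : ℕ → ℕ → ℕ}
    (h : BalancedColouring N M K A T E) (hE : ∀ x < N, ∀ y < N, E' x y = E x y) :
    BalancedColouring N M K A T E' := by
  intro s hs t ht a ha hsK htK haA
  refine (le_of_eq ?_).trans (h s hs t ht a ha hsK htK haA)
  refine Finset.sum_congr rfl fun x hx => Finset.sum_congr rfl fun y hy => ?_
  rw [hE x (Finset.mem_range.1 (hs hx)) y (Finset.mem_range.1 (ht hy))]

/-- The set of numbers below `N` whose indicator function is given by the bits of `b`. -/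
def bitSet (N b : ℕ) : Finset ℕ := (Finset.range N).filter fun i => b.testBit i

theorem exists_bitSet_eq {N : ℕ} {s : Finset ℕ} (hs : s ⊆ Finset.range N) :
    ∃ b < 2 ^ N, bitSet N b = s := by
  refine ⟨lnum (initSeg (fun i => decide (i ∈ s)) N), lnum_initSeg_lt _ _, ?_⟩
  ext i
  have := @hs i
  simp only [bitSet, Finset.mem_filter, Finset.mem_range, testBit_lnum_initSeg] at this ⊢
  by_cases h : i ∈ s <;> simp_all

theorem balancedColouring_iff_bitSet {N M K A T : ℕ} {E : ℕ → ℕ → ℕ} :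
    BalancedColouring N M K A T E ↔ ∀ b < 2 ^ N, ∀ b' < 2 ^ N, ∀ a < 2 ^ M,
      (bitSet N b).card = K → (bitSet N b').card = K → (bitSet M a).card = A →
        ∑ x ∈ bitSet N b, ∑ y ∈ bitSet N b', (if E x y ∈ bitSet M a then 1 else 0) ≤ T := by
  constructor
  · intro h b _ b' _ a _
    exact h _ (Finset.filter_subset _ _) _ (Finset.filter_subset _ _) _ (Finset.filter_subset _ _)
  · intro h s hs t ht a ha
    obtain ⟨b, hb, rfl⟩ := exists_bitSet_eq hs
    obtain ⟨b', hb', rfl⟩ := exists_bitSet_eq ht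
    obtain ⟨a', ha', rfl⟩ := exists_bitSet_eq ha
    exact h b hb b' hb' a' ha'

theorem PrimrecPred.mem_bitSet {α : Type*} [Primcodable α] {f g h : α → ℕ} (hf : Primrec f)
    (hg : Primrec g) (hh : Primrec h) : PrimrecPred fun a => h a ∈ bitSet (f a) (g a) :=
  ((Primrec.nat_lt.comp hh hf).and (PrimrecPred.testBit hg hh)).of_eq fun a => by
    simp [bitSet]

theorem Primrec.sum_bitSet {α : Type*} [Primcodable α] {N b : α → ℕ} {f : α → ℕ → ℕ}
    (hN : Primrec N) (hb : Primrec b) (hf : Primrec₂ f) :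
    Primrec fun a => ∑ i ∈ bitSet (N a) (b a), f a i := by
  refine (Primrec.sum_range (f := fun a i => if (b a).testBit i then f a i else 0)
    (Primrec.ite (PrimrecPred.testBit (hb.comp Primrec.fst) Primrec.snd) hf
      (Primrec.const 0)) hN).of_eq fun a => ?_
  rw [bitSet, Finset.sum_filter]

theorem Primrec.card_bitSet {α : Type*} [Primcodable α] {N b : α → ℕ}
    (hN : Primrec N) (hb : Primrec b) : Primrec fun a => (bitSet (N a) (b a)).card :=
  (Primrec.sum_bitSet (f := fun _ _ => 1) hN hb (Primrec₂.const 1)).of_eq fun a => by simp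

theorem Primrec.codeColouring {α : Type*} [Primcodable α] {N M e x y : α → ℕ}
    (hN : Primrec N) (hM : Primrec M) (he : Primrec e) (hx : Primrec x) (hy : Primrec y) :
    Primrec fun a => codeColouring (N a) (M a) (e a) (x a) (y a) :=
  Primrec.nat_mod.comp (Primrec.nat_beta.comp he (Primrec.nat_add.comp
    (Primrec.nat_mul.comp hx hN) hy)) hM

theorem Primrec.rectangle_count {α : Type*} [Primcodable α] {N M e b b' a : α → ℕ}
    (hN : Primrec N) (hM : Primrec M) (he : Primrec e) (hb : Primrec b) (hb' : Primrec b')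
    (ha : Primrec a) : Primrec fun p => ∑ x ∈ bitSet (N p) (b p), ∑ y ∈ bitSet (N p) (b' p),
      (if _root_.codeColouring (N p) (M p) (e p) x y ∈ bitSet (M p) (a p) then 1 else 0) := by
  have h1 : Primrec fun q : α × ℕ => ∑ y ∈ bitSet (N q.1) (b' q.1),
      (if _root_.codeColouring (N q.1) (M q.1) (e q.1) q.2 y ∈ bitSet (M q.1) (a q.1)
        then 1 else 0) := by
    have h2 : Primrec fun r : (α × ℕ) × ℕ => r.1.1 := .comp .fst .fst
    have h3 : PrimrecPred fun r : (α × ℕ) × ℕ =>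
        _root_.codeColouring (N r.1.1) (M r.1.1) (e r.1.1) r.1.2 r.2 ∈ bitSet (M r.1.1) (a r.1.1) :=
      PrimrecPred.mem_bitSet (hM.comp h2) (ha.comp h2) (Primrec.codeColouring (hN.comp h2)
        (hM.comp h2) (he.comp h2) (.comp .snd .fst) .snd)
    exact Primrec.sum_bitSet (hN.comp .fst) (hb'.comp .fst)
      (Primrec.to₂ (Primrec.ite h3 (Primrec.const 1) (Primrec.const 0)))
  exact Primrec.sum_bitSet hN hb h1.to₂

theorem PrimrecPred.balancedColouring {α : Type*} [Primcodable α] {N M K A T e : α → ℕ}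
    (hN : Primrec N) (hM : Primrec M) (hK : Primrec K) (hA : Primrec A) (hT : Primrec T)
    (he : Primrec e) : PrimrecPred fun p =>
      BalancedColouring (N p) (M p) (K p) (A p) (T p) (codeColouring (N p) (M p) (e p)) := by
  have pow2 : Primrec fun n : ℕ => 2 ^ n := Primrec.nat_pow.comp (Primrec.const 2) Primrec.id
  have q0 : Primrec fun q : ((α × ℕ) × ℕ) × ℕ => q.1.1.1 := .comp .fst (.comp .fst .fst)
  have qb : Primrec fun q : ((α × ℕ) × ℕ) × ℕ => q.1.1.2 := .comp .snd (.comp .fst .fst)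
  have qb' : Primrec fun q : ((α × ℕ) × ℕ) × ℕ => q.1.2 := .comp .snd .fst
  have qa : Primrec fun q : ((α × ℕ) × ℕ) × ℕ => q.2 := .snd
  have key := PrimrecPred.imp
    (Primrec.eq.comp (Primrec.card_bitSet (hN.comp q0) qb) (hK.comp q0))
    (PrimrecPred.imp (Primrec.eq.comp (Primrec.card_bitSet (hN.comp q0) qb') (hK.comp q0))
      (PrimrecPred.imp (Primrec.eq.comp (Primrec.card_bitSet (hM.comp q0) qa) (hA.comp q0))
        (Primrec.nat_le.comp (Primrec.rectangle_count (hN.comp q0) (hM.comp q0) (he.comp q0)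
          qb qb' qa) (hT.comp q0))))
  exact (PrimrecPred.forall_lt₃ (R := fun p b b' a =>
    (bitSet (N p) b).card = K p → (bitSet (N p) b').card = K p → (bitSet (M p) a).card = A p →
      ∑ x ∈ bitSet (N p) b, ∑ y ∈ bitSet (N p) b',
        (if codeColouring (N p) (M p) (e p) x y ∈ bitSet (M p) a then 1 else 0) ≤ T p) key
    (pow2.comp hN) (pow2.comp hN) (pow2.comp hM)).of_eq fun p => balancedColouring_iff_bitSet.symm

theorem exists_computable_of_primrecRel {α : Type*} [Primcodable α] {R : α → ℕ → Prop}
    (hR : PrimrecRel R) (h : ∀ a, ∃ n, R a n) :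
    ∃ f : α → ℕ, Computable f ∧ ∀ a, R a (f a) ∧ ∀ m < f a, ¬ R a m := by
  classical
  refine ⟨fun a => Nat.find (h a), ?_, fun a => ⟨Nat.find_spec (h a), fun m hm =>
    Nat.find_min (h a) hm⟩⟩
  refine (Partrec.rfind (p := fun a n => Part.some (decide (R a n)))
    (hR.decide.to_comp.partrec₂)).of_eq_tot fun a => ?_
  refine Nat.mem_rfind.2 ⟨?_, fun {m} hm => ?_⟩
  · simpa using Nat.find_spec (h a)
  · simpa using Nat.find_min (h a) hm

/-- The colouring `E` of pairs of `2 ^ u`-bit strings by `B * (l + 1) * u`-bit strings behaves, up to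
a constant factor, like a random colouring on rectangles of side at least
`2 ^ (u + B * (l + 1) * u + B * u + 2)`, for sets of `2 ^ (B * l * u + 1)` colours. -/
def IsExtractor (B l u : ℕ) (E : ℕ → ℕ → ℕ) : Prop :=
  BalancedColouring (2 ^ 2 ^ u) (2 ^ (B * (l + 1) * u)) (2 ^ (u + B * (l + 1) * u + B * u + 2))
    (2 ^ (B * l * u + 1)) (2 ^ (2 * (u + B * (l + 1) * u + B * u + 2) - (B * u - 1) + 2)) E

theorem exists_isExtractor {B : ℕ} (hB : 0 < B) (l u : ℕ) :
    ∃ e, IsExtractor B l u (codeColouring (2 ^ 2 ^ u) (2 ^ (B * (l + 1) * u)) e) := by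
  rcases Nat.eq_zero_or_pos u with rfl | hu
  · refine ⟨0, fun s _ t _ a ha _ _ haA => ?_⟩
    have := Finset.card_le_card ha
    rw [haA] at this
    simp at this
  have hBu : 0 < B * u := Nat.mul_pos hB hu
  have hm : B * (l + 1) * u = B * l * u + B * u := by ring
  unfold IsExtractor
  generalize hk : u + B * (l + 1) * u + B * u + 2 = k
  obtain ⟨E, hEM, hE⟩ := exists_balanced (n := 2 ^ u) (M := 2 ^ (B * (l + 1) * u)) (K := 2 ^ k)
    (A := 2 ^ (B * l * u + 1)) (G := 2 ^ (B * u - 1)) (j := 2 ^ (2 * k - (B * u - 1)))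
    (by rw [← pow_add]; congr 1; omega) (by positivity)
    (by rw [← pow_add, ← pow_add]; congr 1; omega)
    (by
      have h1 : 2 * 2 ^ u * 2 ^ k = 2 ^ (u + k + 1) := by ring
      have h3 : 2 ^ (u + k + 1) ≤ 2 ^ (2 * k - (B * u - 1)) :=
        Nat.pow_le_pow_right (by norm_num) (by omega)
      have h4 : 2 ^ (B * (l + 1) * u) < 2 ^ (2 * k - (B * u - 1)) :=
        Nat.pow_lt_pow_right (by norm_num) (by omega)
      rw [h1]
      omega)
  obtain ⟨e, he⟩ := exists_codeColouring_eq _ _ E hEM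
  refine ⟨e, BalancedColouring.congr ?_ he⟩
  have hT : 2 ^ (2 * k - (B * u - 1) + 2) = 4 * 2 ^ (2 * k - (B * u - 1)) := by ring
  rwa [hT]

theorem primrecRel_isExtractor (B l : ℕ) : PrimrecRel fun u e =>
    IsExtractor B l u (codeColouring (2 ^ 2 ^ u) (2 ^ (B * (l + 1) * u)) e) := by
  have pow2 : Primrec fun n : ℕ => 2 ^ n := Primrec.nat_pow.comp (Primrec.const 2) Primrec.id
  have mulc : ∀ c : ℕ, Primrec fun u : ℕ => c * u := fun c =>
    Primrec.nat_mul.comp (Primrec.const c) Primrec.id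
  have hk : Primrec fun u => u + B * (l + 1) * u + B * u + 2 :=
    Primrec.nat_add.comp (Primrec.nat_add.comp (Primrec.nat_add.comp Primrec.id (mulc _))
      (mulc _)) (Primrec.const 2)
  have hN : Primrec fun u : ℕ => 2 ^ 2 ^ u := pow2.comp pow2
  have hM : Primrec fun u : ℕ => 2 ^ (B * (l + 1) * u) := pow2.comp (mulc _)
  have hA : Primrec fun u : ℕ => 2 ^ (B * l * u + 1) :=
    pow2.comp (Primrec.nat_add.comp (mulc _) (Primrec.const 1))
  have hT : Primrec fun u : ℕ => 2 ^ (2 * (u + B * (l + 1) * u + B * u + 2) - (B * u - 1) + 2) :=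
    pow2.comp (Primrec.nat_add.comp (Primrec.nat_sub.comp
      ((mulc 2).comp hk) (Primrec.nat_sub.comp (mulc B) (Primrec.const 1))) (Primrec.const 2))
  exact PrimrecPred.primrecRel (PrimrecPred.balancedColouring (hN.comp .fst) (hM.comp .fst)
    (pow2.comp (hk.comp .fst)) (hA.comp .fst) (hT.comp .fst) .snd)

theorem computable_codeColouring {N M e : ℕ → ℕ} (hN : Primrec N) (hM : Primrec M)
    (he : Computable e) : Computable fun q : ℕ × ℕ × ℕ =>
      codeColouring (N q.1) (M q.1) (e q.1) q.2.1 q.2.2 := by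
  have hu : Primrec fun r : (ℕ × ℕ) × ℕ × ℕ => r.1.1 := .comp .fst .fst
  have hc : Primrec fun r : (ℕ × ℕ) × ℕ × ℕ =>
      codeColouring (N r.1.1) (M r.1.1) r.1.2 r.2.1 r.2.2 :=
    Primrec.codeColouring (hN.comp hu) (hM.comp hu)
      (.comp .snd .fst) (.comp .fst .snd) (.comp .snd .snd)
  have hg : Computable fun q : ℕ × ℕ × ℕ => ((q.1, e q.1), q.2) :=
    Computable.pair (Computable.pair Computable.fst (he.comp Computable.fst)) Computable.snd
  have := hc.to_comp.comp hg
  exact this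

theorem exists_computable_isExtractor {B : ℕ} (hB : 0 < B) (l : ℕ) :
    ∃ E : ℕ → ℕ → ℕ → ℕ, Computable (fun q : ℕ × ℕ × ℕ => E q.1 q.2.1 q.2.2) ∧
      ∀ u, (∀ x y, E u x y < 2 ^ (B * (l + 1) * u)) ∧ IsExtractor B l u (E u) := by
  obtain ⟨e, hcomp, he⟩ := exists_computable_of_primrecRel (primrecRel_isExtractor B l)
    (exists_isExtractor hB l)
  have pow2 : Primrec fun n : ℕ => 2 ^ n := Primrec.nat_pow.comp (Primrec.const 2) Primrec.id
  have hc := computable_codeColouring (pow2.comp pow2)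
    (pow2.comp (Primrec.nat_mul.comp (Primrec.const (B * (l + 1))) Primrec.id)) hcomp
  exact ⟨fun u => codeColouring (2 ^ 2 ^ u) (2 ^ (B * (l + 1) * u)) (e u), hc,
    fun u => ⟨fun x y => codeColouring_lt (by positivity), (he u).1⟩⟩

namespace OracleComputable

theorem of_eq {f g : BinSeq → BinSeq → ℕ →. ℕ} (hf : OracleComputable f)
    (h : ∀ x y n, f x y n = g x y n) : OracleComputable g := by
  have : f = g := funext fun x => funext fun y => funext fun n => h x y n
  exact this ▸ hf

theorem of_partrec {f : ℕ →. ℕ} (hf : Nat.Partrec f) : OracleComputable fun _ _ => f := by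
  induction hf with
  | zero => exact .zero
  | succ => exact .succ
  | left => exact .left
  | right => exact .right
  | pair _ _ hf hg => exact .pair hf hg
  | comp _ _ hf hg => exact .comp hf hg
  | prec _ _ hf hg => exact .prec hf hg
  | rfind _ hf => exact .rfind hf

theorem of_computable {f : ℕ → ℕ} (hf : Computable f) :
    OracleComputable fun _ _ n => Part.some (f n) :=
  of_partrec (Partrec.nat_iff.1 hf)

theorem comp_total {f g : BinSeq → BinSeq → ℕ → ℕ}
    (hf : OracleComputable fun x y n => Part.some (f x y n))
    (hg : OracleComputable fun x y n => Part.some (g x y n)) :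
    OracleComputable fun x y n => Part.some (f x y (g x y n)) := by
  have := hf.comp hg
  simpa only [Part.bind_eq_bind, Part.bind_some] using this

theorem pair_total {f g : BinSeq → BinSeq → ℕ → ℕ}
    (hf : OracleComputable fun x y n => Part.some (f x y n))
    (hg : OracleComputable fun x y n => Part.some (g x y n)) :
    OracleComputable fun x y n => Part.some (Nat.pair (f x y n) (g x y n)) := by
  have := hf.pair hg
  simpa [Seq.seq] using this

theorem prec_total {f g : BinSeq → BinSeq → ℕ → ℕ}
    (hf : OracleComputable fun x y n => Part.some (f x y n))
    (hg : OracleComputable fun x y n => Part.some (g x y n)) :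
    OracleComputable fun x y => Nat.unpaired fun a n => Part.some
      (n.rec (f x y a) fun k i => g x y (Nat.pair a (Nat.pair k i)) : ℕ) := by
  refine (hf.prec hg).of_eq fun x y m => ?_
  simp only [Nat.unpaired, Part.bind_eq_bind]
  induction m.unpair.2 with
  | zero => rfl
  | succ n ih => simp only [ih, Part.bind_some]

theorem lnum_initSeg {q : BinSeq → BinSeq → BinSeq}
    (hq : OracleComputable fun x y n => Part.some (q x y n).toNat) {n : ℕ → ℕ}
    (hn : Computable n) :
    OracleComputable fun x y p => Part.some (lnum (initSeg (q x y) (n p))) := by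
  have hstep : OracleComputable fun x y m => Part.some
      (m.unpair.2.unpair.2 + 2 ^ m.unpair.2.unpair.1 * (q x y m.unpair.2.unpair.1).toNat) := by
    have hk : Primrec fun m : ℕ => m.unpair.2.unpair.1 :=
      .comp .fst (.comp .unpair (.comp .snd .unpair))
    have hG : Primrec fun m : ℕ => m.unpair.1.unpair.2.unpair.2
        + 2 ^ m.unpair.1.unpair.2.unpair.1 * m.unpair.2 :=
      Primrec.nat_add.comp (.comp .snd (.comp .unpair (.comp .snd (.comp .unpair
        (.comp .fst .unpair))))) (Primrec.nat_mul.comp (Primrec.nat_pow.comp (Primrec.const 2)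
          (hk.comp (.comp .fst .unpair))) (.comp .snd .unpair))
    have := (of_computable hG.to_comp).comp_total ((of_computable Computable.id).pair_total
      (hq.comp_total (of_computable hk.to_comp)))
    simpa using this
  have h := (prec_total (of_computable (Computable.const 0)) hstep)
  have h2 : OracleComputable fun x y m => Part.some (lnum (initSeg (q x y) m.unpair.2)) := by
    refine h.of_eq fun x y m => ?_
    simp only [Nat.unpaired, Nat.unpair_pair]
    congr 1
    induction m.unpair.2 with
    | zero => simp [initSeg]
    | succ k ih => simp [initSeg_succ, lnum_append, ih]
  have h3 : Computable fun p => Nat.pair 0 (n p) :=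
    Primrec₂.natPair.to_comp.comp (Computable.const 0) hn
  simpa using h2.comp_total (of_computable h3)

end OracleComputable

theorem isTruthTableReduction_of_initSeg {g : ℕ × ℕ × ℕ → Bool} (hg : Computable g) {n : ℕ → ℕ}
    (hn : Computable n) : IsTruthTableReduction fun x y p =>
      g (p, lnum (initSeg x (n p)), lnum (initSeg y (n p))) := by
  have h1 : Computable fun m : ℕ => (g (m.unpair.1, m.unpair.2.unpair.1, m.unpair.2.unpair.2)).toNat :=
    (Primrec.dom_bool Bool.toNat).to_comp.comp (hg.comp (Primrec.to_comp
      (.pair (.comp .fst .unpair) (.pair (.comp .fst (.comp .unpair (.comp .snd .unpair)))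
        (.comp .snd (.comp .unpair (.comp .snd .unpair)))))))
  have := (OracleComputable.of_computable h1).comp_total
    ((OracleComputable.of_computable Computable.id).pair_total
      ((OracleComputable.lnum_initSeg (q := fun x _ => x) .queryFirst hn).pair_total
        (OracleComputable.lnum_initSeg (q := fun _ y => y) .querySecond hn)))
  simpa [IsTruthTableReduction] using this

theorem machineComplexity_le {M : Machine} {p x : List Bool} (h : x ∈ M p) :
    machineComplexity M x ≤ p.length :=
  iInf₂_le p h

theorem exists_program_of_machineComplexity_le {M : Machine} {x : List Bool} {n : ℕ}
    (h : machineComplexity M x ≤ n) : ∃ p, x ∈ M p ∧ p.length ≤ n := by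
  by_contra! hcon
  have : ((n + 1 : ℕ) : ℕ∞) ≤ machineComplexity M x :=
    le_iInf₂ fun p hp => by exact_mod_cast hcon p hp
  have := this.trans h
  norm_cast at this
  omega

theorem IsUniversalMachine.exists_plainK_le {U : Machine} (hU : IsUniversalMachine U) {M : Machine}
    (hM : Partrec M) : ∃ c, ∀ p x, x ∈ M p → plainK U x ≤ p.length + c := by
  obtain ⟨c, hc⟩ := hU.2 M hM
  refine ⟨c, fun p x hx => ENat.toNat_le_of_le_natCast ?_⟩
  refine (hc x).trans ?_
  push_cast
  gcongr
  exact machineComplexity_le hx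

theorem IsUniversalMachine.exists_plainK_le_length {U : Machine} (hU : IsUniversalMachine U) :
    ∃ c, ∀ x, plainK U x ≤ x.length + c := by
  obtain ⟨c, hc⟩ := hU.exists_plainK_le (M := fun p => Part.some p) Computable.id.partrec
  exact ⟨c, fun x => hc x x (Part.mem_some x)⟩

theorem IsUniversalMachine.exists_program {U : Machine} (hU : IsUniversalMachine U)
    (x : List Bool) : ∃ p, x ∈ U p ∧ p.length ≤ plainK U x := by
  obtain ⟨c, hc⟩ := hU.2 (fun p => Part.some p) Computable.id.partrec
  refine exists_program_of_machineComplexity_le ?_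
  have h : machineComplexity U x ≠ ⊤ := by
    refine ne_top_of_le_ne_top ?_ ((hc x).trans (add_le_add_left
      (machineComplexity_le (Part.mem_some x)) _))
    norm_cast
    exact ENat.natCast_ne_top _
  rw [plainK, ENat.natCast_toNat h]

/-- The distinct values among the first `s` terms of an enumeration, in order of appearance. -/
def distinctValues {α : Type*} [DecidableEq α] (g : ℕ → Option α) : ℕ → List α
  | 0 => []
  | s + 1 => (g s).elim (distinctValues g s) fun w =>
      if w ∈ distinctValues g s then distinctValues g s else distinctValues g s ++ [w]

section distinctValues

variable {α : Type*} [DecidableEq α] {g : ℕ → Option α}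

theorem distinctValues_prefix_succ (s : ℕ) :
    distinctValues g s <+: distinctValues g (s + 1) := by
  rw [distinctValues]
  cases g s with
  | none => exact List.prefix_rfl
  | some w =>
    simp only [Option.elim_some]
    split
    · exact List.prefix_rfl
    · exact List.prefix_append _ _

theorem distinctValues_prefix {s t : ℕ} (h : s ≤ t) :
    distinctValues g s <+: distinctValues g t := by
  induction h with
  | refl => exact List.prefix_rfl
  | step _ ih => exact ih.trans (distinctValues_prefix_succ _)

theorem nodup_distinctValues (s : ℕ) : (distinctValues g s).Nodup := by
  induction s with
  | zero => exact List.nodup_nil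
  | succ s ih =>
    rw [distinctValues]
    cases g s with
    | none => exact ih
    | some w =>
      simp only [Option.elim_some]
      split
      · exact ih
      · next h => exact List.nodup_append.2 ⟨ih, List.nodup_singleton _, by
          rintro a ha b hb rfl
          exact h (List.mem_singleton.1 hb ▸ ha)⟩

theorem mem_distinctValues {s : ℕ} {w : α} :
    w ∈ distinctValues g s ↔ ∃ t < s, g t = some w := by
  induction s with
  | zero => simp [distinctValues]
  | succ s ih =>
    rw [distinctValues]
    simp only [Nat.lt_succ_iff_lt_or_eq, or_and_right, exists_or, exists_eq_left, ← ih]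
    cases g s with
    | none => simp
    | some v =>
      simp only [Option.elim_some, Option.some.injEq]
      split
      · next h => exact ⟨Or.inl, fun h' => h'.elim id fun e => e ▸ h⟩
      · simp [eq_comm]

end distinctValues

theorem Computable₂.distinctValues {α β : Type*} [Primcodable α] [Primcodable β] [DecidableEq β]
    {g : α → ℕ → Option β} (hg : Computable₂ g) :
    Computable₂ fun a s => distinctValues (g a) s := by
  have hmem : PrimrecRel fun (L : List β) (w : β) => w ∈ L :=
    (PrimrecRel.exists_mem_list (R := fun a b : β => a = b) Primrec.eq).of_eq fun L w => by simp
  have hstep : Primrec₂ fun (o : Option β) (L : List β) =>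
      o.elim L fun w => if w ∈ L then L else L ++ [w] := by
    have h1 : Primrec₂ fun (q : Option β × List β) (w : β) =>
        if w ∈ q.2 then q.2 else q.2 ++ [w] :=
      Primrec.ite (hmem.comp (.comp .snd .fst) .snd) (.comp .snd .fst)
        (Primrec.list_concat.comp (.comp .snd .fst) .snd)
    refine (Primrec.option_casesOn (o := fun q : Option β × List β => q.1) .fst .snd h1).of_eq ?_
    rintro ⟨o, L⟩
    cases o <;> rfl
  have hh : Computable₂ fun (q : α × ℕ) (r : ℕ × List β) =>
      (g q.1 r.1).elim r.2 fun w => if w ∈ r.2 then r.2 else r.2 ++ [w] := by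
    have h1 : Computable fun q : (α × ℕ) × ℕ × List β => g q.1.1 q.2.1 :=
      hg.comp (.comp .fst .fst) (.comp .fst .snd)
    have h2 : Computable fun q : (α × ℕ) × ℕ × List β => q.2.2 := .comp .snd .snd
    have := hstep.to_comp.comp h1 h2
    exact this
  refine (Computable.nat_rec (f := fun q : α × ℕ => q.2) (g := fun _ => []) .snd
    (Computable.const []) hh).of_eq ?_
  rintro ⟨a, s⟩
  induction s with
  | zero => rfl
  | succ s ih =>
    dsimp only at ih ⊢
    rw [ih, _root_.distinctValues]

theorem Primrec.lnum : Primrec lnum := by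
  have h : Primrec₂ fun (_ : List Bool) (q : Bool × ℕ) => 2 * q.2 + q.1.toNat :=
    Primrec.nat_add.comp (Primrec.nat_mul.comp (Primrec.const 2) (.comp .snd .snd))
      ((Primrec.dom_bool Bool.toNat).comp (.comp .fst .snd))
  exact Primrec.list_foldr Primrec.id (Primrec.const 0) h

/-- The first component of the pair coded by a program `1ᵏ 0 a b` with `|a| = k`. -/
def headerNum (p : List Bool) : ℕ :=
  lnum ((p.drop ((p.takeWhile id).length + 1)).take (p.takeWhile id).length)

/-- The second component of the pair coded by a program `1ᵏ 0 a b` with `|a| = k`. -/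
def payloadNum (p : List Bool) : ℕ :=
  lnum ((p.drop ((p.takeWhile id).length + 1)).drop (p.takeWhile id).length)

theorem Primrec.headerNum : Primrec headerNum := by
  have hk : Primrec fun p : List Bool => (p.takeWhile id).length :=
    Primrec.list_length.comp (Primrec.list_takeWhile Primrec.id)
  exact Primrec.lnum.comp (Primrec.list_take.comp hk
    (Primrec.list_drop.comp (Primrec.succ.comp hk) Primrec.id))

theorem Primrec.payloadNum : Primrec payloadNum := by
  have hk : Primrec fun p : List Bool => (p.takeWhile id).length :=
    Primrec.list_length.comp (Primrec.list_takeWhile Primrec.id)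
  exact Primrec.lnum.comp (Primrec.list_drop.comp hk
    (Primrec.list_drop.comp (Primrec.succ.comp hk) Primrec.id))

theorem exists_headerNum_payloadNum {h i k l : ℕ} (hh : h < 2 ^ k) (hi : i < 2 ^ l) :
    ∃ p : List Bool, headerNum p = h ∧ payloadNum p = i ∧ p.length = 2 * k + 1 + l := by
  let a := initSeg (fun j => h.testBit j) k
  let b := initSeg (fun j => i.testBit j) l
  have ha : a.length = k := length_initSeg _ _
  refine ⟨List.replicate k true ++ false :: (a ++ b), ?_, ?_, ?_⟩
  all_goals
    have h1 : ((List.replicate k true ++ false :: (a ++ b)).takeWhile id).length = k := by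
      rw [List.takeWhile_append]
      simp
    have h2 : (List.replicate k true ++ false :: (a ++ b)).drop (k + 1) = a ++ b := by
      rw [List.drop_append]
      simp
  · rw [headerNum, h1, h2, List.take_left' ha]
    exact lnum_initSeg_testBit hh
  · rw [payloadNum, h1, h2, List.drop_left' ha]
    exact lnum_initSeg_testBit hi
  · simp [a, b]; ring

theorem IsUniversalMachine.exists_plainK_le_of_enumeration {U : Machine}
    (hU : IsUniversalMachine U) {g : ℕ → ℕ → Option (List Bool)} (hg : Computable₂ g) :
    ∃ d, ∀ (h k l : ℕ) (S : Finset (List Bool)), h < 2 ^ k → S.card ≤ 2 ^ l →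
      (∀ s w, g h s = some w → w ∈ S) → ∀ s w, g h s = some w →
        plainK U w ≤ 2 * k + l + d := by
  let F : List Bool → ℕ → Option (List Bool) := fun p s =>
    (distinctValues (g (headerNum p)) s)[payloadNum p]?
  have hF : Computable₂ F := by
    have h1 : Computable fun q : List Bool × ℕ => distinctValues (g (headerNum q.1)) q.2 :=
      hg.distinctValues.comp (Primrec.headerNum.to_comp.comp .fst) .snd
    exact Computable.list_getElem?.comp h1 (Primrec.payloadNum.to_comp.comp .fst)
  obtain ⟨c, hc⟩ := hU.exists_plainK_le (Partrec.rfindOpt hF)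
  refine ⟨c + 1, fun h k l S hh hS hgS s w hw => ?_⟩
  obtain ⟨i, hi, hiw⟩ := List.getElem_of_mem (mem_distinctValues.2 ⟨s, Nat.lt_succ_self s, hw⟩)
  have hlen : (distinctValues (g h) (s + 1)).length ≤ 2 ^ l := by
    rw [← List.toFinset_card_of_nodup (nodup_distinctValues _)]
    refine (Finset.card_le_card fun v hv => ?_).trans hS
    obtain ⟨t, _, ht⟩ := mem_distinctValues.1 (List.mem_toFinset.1 hv)
    exact hgS t v ht
  obtain ⟨p, hp1, hp2, hp3⟩ := exists_headerNum_payloadNum hh (hi.trans_le hlen)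
  have hmem : w ∈ Nat.rfindOpt (F p) := by
    refine (Nat.rfindOpt_mono ?_).2 ⟨s + 1, ?_⟩
    · intro a m n hmn ha
      have hpre : distinctValues (g (headerNum p)) m <+: distinctValues (g (headerNum p)) n :=
        distinctValues_prefix hmn
      obtain ⟨r, hr⟩ := hpre
      simp only [F, Option.mem_def, ← hr] at ha ⊢
      obtain ⟨hlt, _⟩ := List.getElem?_eq_some_iff.1 ha
      rw [List.getElem?_append_left hlt, ha]
    · simp only [F, hp1, hp2, Option.mem_def]
      exact List.getElem?_eq_some_iff.2 ⟨hi, hiw⟩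
  have := hc p w hmem
  omega

theorem exists_graph_enumeration {α β : Type*} [Primcodable α] [Primcodable β] {f : α →. β}
    (hf : Partrec f) :
    ∃ V : ℕ → Option (α × β), Computable V ∧ ∀ a b, b ∈ f a ↔ ∃ s, V s = some (a, b) := by
  obtain ⟨c, hc⟩ := Nat.Partrec.Code.exists_code.1 hf
  let W : α → ℕ → Option β := fun a k => (c.evaln k (Encodable.encode a)).bind Encodable.decode
  have hW : Primrec₂ W := by
    have h1 : Primrec fun q : α × ℕ => c.evaln q.2 (Encodable.encode q.1) :=
      Nat.Partrec.Code.primrec_evaln.comp (Primrec.pair (Primrec.pair .snd (Primrec.const c))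
        (Primrec.encode.comp .fst))
    exact Primrec.option_bind h1 (Primrec.decode.comp .snd).to₂
  have hWf : ∀ a b, b ∈ f a ↔ ∃ k, W a k = some b := by
    intro a b
    have h1 : ∀ m, m ∈ c.eval (Encodable.encode a) ↔ ∃ b ∈ f a, Encodable.encode b = m := by
      intro m
      rw [hc]
      simp [Encodable.encodek]
    constructor
    · intro hb
      obtain ⟨k, hk⟩ := Nat.Partrec.Code.evaln_complete.1 ((h1 _).2 ⟨b, hb, rfl⟩)
      refine ⟨k, ?_⟩
      simp only [W, Option.mem_def.1 hk, Option.bind_some, Encodable.encodek]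
    · rintro ⟨k, hk⟩
      obtain ⟨m, hm, hmb⟩ := Option.bind_eq_some_iff.1 hk
      obtain ⟨b', hb', rfl⟩ := (h1 m).1 (Nat.Partrec.Code.evaln_sound hm)
      rw [Encodable.encodek, Option.some.injEq] at hmb
      exact hmb ▸ hb'
  refine ⟨fun s => (Encodable.decode (α := α × ℕ) s).bind fun q =>
    (W q.1 q.2).map fun b => (q.1, b), ?_, fun a b => ?_⟩
  · have h1 : Primrec₂ fun (_ : ℕ) (q : α × ℕ) => (W q.1 q.2).map fun b => (q.1, b) := by
      have h2 : Primrec fun q : ℕ × α × ℕ => W q.2.1 q.2.2 :=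
        hW.comp (.comp .fst .snd) (.comp .snd .snd)
      have h3 : Primrec₂ fun (q : ℕ × α × ℕ) (b : β) => (q.2.1, b) :=
        Primrec.pair (.comp .fst (.comp .snd .fst)) .snd
      exact Primrec.option_map h2 h3
    exact (Primrec.option_bind Primrec.decode h1).to_comp
  · rw [hWf]
    constructor
    · rintro ⟨k, hk⟩
      exact ⟨Encodable.encode (a, k), by simp [hk]⟩
    · rintro ⟨s, hs⟩
      obtain ⟨q, -, hq⟩ := Option.bind_eq_some_iff.1 hs
      obtain ⟨b', hb', h⟩ := Option.map_eq_some_iff.1 hq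
      obtain ⟨rfl, rfl⟩ := Prod.mk.inj h
      exact ⟨_, hb'⟩

theorem exists_finset_length_le (t : ℕ) :
    ∃ S : Finset (List Bool), S.card < 2 ^ (t + 1) ∧ ∀ p : List Bool, p.length ≤ t → p ∈ S := by
  induction t with
  | zero => exact ⟨{[]}, by simp, fun p hp => by simpa using hp⟩
  | succ t ih =>
    obtain ⟨S, hS, h⟩ := ih
    refine ⟨insert [] (S.image (List.cons true) ∪ S.image (List.cons false)), ?_, ?_⟩
    · have h1 := Finset.card_insert_le [] (S.image (List.cons true) ∪ S.image (List.cons false))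
      have h2 := Finset.card_union_le (S.image (List.cons true)) (S.image (List.cons false))
      have h3 := Finset.card_image_le (s := S) (f := List.cons true)
      have h4 := Finset.card_image_le (s := S) (f := List.cons false)
      rw [pow_succ]
      omega
    · intro p hp
      cases p with
      | nil => simp
      | cons b p =>
        have := h p (by simpa using hp)
        cases b <;> simp [this]

theorem exists_finset_outputs (M : Machine) (t : ℕ) :
    ∃ S : Finset (List Bool), S.card ≤ 2 ^ (t + 1) ∧
      ∀ p w, p.length ≤ t → w ∈ M p → w ∈ S := by
  classical
  obtain ⟨S, hS, h⟩ := exists_finset_length_le t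
  refine ⟨S.image fun p => if hp : (M p).Dom then (M p).get hp else [],
    Finset.card_image_le.trans hS.le, fun p w hp hw => Finset.mem_image.2 ⟨p, h p hp, ?_⟩⟩
  obtain ⟨hd, rfl⟩ := hw
  rw [dif_pos hd]

/-- The strings `x ++ y` found at stage `s` of the enumeration with parameters `u`, `t₁`, `t₂` coded
in `h`: `V` enumerates the graph of a machine, `x` and `y` have `2 ^ u` bits and programs of length
at most `t₁` and `t₂`, and the colour of `(x, y)` is the tail of a string of length `B * (l + 2) * u`
with a program of length at most `B * l * u`. -/
def badPairs (V : ℕ → Option (List Bool × List Bool)) (E : ℕ → ℕ → ℕ → ℕ) (B l h s : ℕ) :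
    Option (List Bool) :=
  (V s.unpair.1).bind fun a => (V s.unpair.2.unpair.1).bind fun b =>
    (V s.unpair.2.unpair.2).bind fun c =>
      if a.1.length ≤ h.unpair.2.unpair.1 ∧ b.1.length ≤ h.unpair.2.unpair.2 ∧
          c.1.length ≤ B * l * h.unpair.1 ∧ a.2.length = 2 ^ h.unpair.1 ∧
          b.2.length = 2 ^ h.unpair.1 ∧ c.2.length = B * (l + 2) * h.unpair.1 ∧
          E h.unpair.1 (lnum a.2) (lnum b.2) = lnum (c.2.drop (B * h.unpair.1))
      then some (a.2 ++ b.2) else none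

theorem computable₂_badPairs {V : ℕ → Option (List Bool × List Bool)} (hV : Computable V)
    {E : ℕ → ℕ → ℕ → ℕ} (hE : Computable fun q : ℕ × ℕ × ℕ => E q.1 q.2.1 q.2.2) (B l : ℕ) :
    Computable₂ (badPairs V E B l) := by
  let α := ((ℕ × ℕ) × (List Bool × List Bool)) × (List Bool × List Bool)
  let β := α × (List Bool × List Bool)
  let P : β → ℕ → Prop := fun q e =>
    q.1.1.2.1.length ≤ q.1.1.1.1.unpair.2.unpair.1 ∧
    q.1.2.1.length ≤ q.1.1.1.1.unpair.2.unpair.2 ∧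
    q.2.1.length ≤ B * l * q.1.1.1.1.unpair.1 ∧ q.1.1.2.2.length = 2 ^ q.1.1.1.1.unpair.1 ∧
    q.1.2.2.length = 2 ^ q.1.1.1.1.unpair.1 ∧ q.2.2.length = B * (l + 2) * q.1.1.1.1.unpair.1 ∧
    e = lnum (q.2.2.drop (B * q.1.1.1.1.unpair.1))
  have hh : Primrec fun q : β × ℕ => q.1.1.1.1.1 := .comp .fst (.comp .fst (.comp .fst (.comp .fst .fst)))
  have ha : Primrec fun q : β × ℕ => q.1.1.1.2 := .comp .snd (.comp .fst (.comp .fst .fst))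
  have hb : Primrec fun q : β × ℕ => q.1.1.2 := .comp .snd (.comp .fst .fst)
  have hc : Primrec fun q : β × ℕ => q.1.2 := .comp .snd .fst
  have hu : Primrec fun q : β × ℕ => q.1.1.1.1.1.unpair.1 := .comp .fst (.comp .unpair hh)
  have ht : Primrec fun q : β × ℕ => q.1.1.1.1.1.unpair.2.unpair :=
    .comp .unpair (.comp .snd (.comp .unpair hh))
  have hmul : ∀ c : ℕ, Primrec fun q : β × ℕ => c * q.1.1.1.1.1.unpair.1 := fun c =>
    Primrec.nat_mul.comp (Primrec.const c) hu
  have hpow : Primrec fun q : β × ℕ => 2 ^ q.1.1.1.1.1.unpair.1 :=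
    Primrec.nat_pow.comp (Primrec.const 2) hu
  have hP : PrimrecPred fun q : β × ℕ => P q.1 q.2 :=
    (Primrec.nat_le.comp (Primrec.list_length.comp (.comp .fst ha)) (.comp .fst ht)).and <|
    (Primrec.nat_le.comp (Primrec.list_length.comp (.comp .fst hb)) (.comp .snd ht)).and <|
    (Primrec.nat_le.comp (Primrec.list_length.comp (.comp .fst hc)) (hmul (B * l))).and <|
    (Primrec.eq.comp (Primrec.list_length.comp (.comp .snd ha)) hpow).and <|
    (Primrec.eq.comp (Primrec.list_length.comp (.comp .snd hb)) hpow).and <|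
    (Primrec.eq.comp (Primrec.list_length.comp (.comp .snd hc)) (hmul (B * (l + 2)))).and <|
    (Primrec.eq.comp .snd (Primrec.lnum.comp (Primrec.list_drop.comp (hmul B) (.comp .snd hc))))
  have hout : Primrec fun q : β × ℕ => some (q.1.1.1.2.2 ++ q.1.1.2.2) :=
    Primrec.option_some.comp (Primrec.list_append.comp (.comp .snd ha) (.comp .snd hb))
  classical
  have hite : Primrec fun q : β × ℕ =>
      if P q.1 q.2 then some (q.1.1.1.2.2 ++ q.1.1.2.2) else none :=
    Primrec.ite hP hout (Primrec.const none)
  have hEc : Computable fun q : β => E q.1.1.1.1.unpair.1 (lnum q.1.1.2.2) (lnum q.1.2.2) := by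
    have h1 : Primrec fun q : β =>
        (q.1.1.1.1.unpair.1, lnum q.1.1.2.2, lnum q.1.2.2) :=
      .pair (.comp .fst (.comp .unpair (.comp .fst (.comp .fst (.comp .fst .fst)))))
        (.pair (Primrec.lnum.comp (.comp .snd (.comp .snd (.comp .fst .fst))))
          (Primrec.lnum.comp (.comp .snd (.comp .snd .fst))))
    have := hE.comp h1.to_comp
    exact this
  have h3 : Computable fun q : β =>
      if P q (E q.1.1.1.1.unpair.1 (lnum q.1.1.2.2) (lnum q.1.2.2))
      then some (q.1.1.2.2 ++ q.1.2.2) else none := by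
    have := hite.to_comp.comp (Computable.pair Computable.id hEc)
    exact this
  have hs : Primrec fun q : ℕ × ℕ => q.2.unpair := .comp .unpair .snd
  have v1 : Computable fun q : ℕ × ℕ => V q.2.unpair.1 := hV.comp (Primrec.to_comp (.comp .fst hs))
  have v2 : Computable fun q : (ℕ × ℕ) × (List Bool × List Bool) => V q.1.2.unpair.2.unpair.1 :=
    hV.comp (Primrec.to_comp (.comp .fst (.comp .unpair (.comp .snd (.comp .unpair (.comp .snd .fst))))))
  have v3 : Computable fun q : α => V q.1.1.2.unpair.2.unpair.2 :=
    hV.comp (Primrec.to_comp (.comp .snd (.comp .unpair (.comp .snd (.comp .unpair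
      (.comp .snd (.comp .fst .fst)))))))
  have w3 := Computable.option_bind v3 h3.to₂
  have w2 := Computable.option_bind v2 w3.to₂
  have w1 := Computable.option_bind v1 w2.to₂
  refine Computable.of_eq w1 ?_
  rintro ⟨h, s⟩
  simp only [badPairs, P]

theorem badPairs_eq_some {V : ℕ → Option (List Bool × List Bool)} {E : ℕ → ℕ → ℕ → ℕ}
    {U : Machine} (hV : ∀ a b, b ∈ U a ↔ ∃ s, V s = some (a, b)) {B l u t₁ t₂ : ℕ}
    {w : List Bool} :
    (∃ s, badPairs V E B l (Nat.pair u (Nat.pair t₁ t₂)) s = some w) ↔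
      ∃ p q r x y z, x ∈ U p ∧ y ∈ U q ∧ z ∈ U r ∧ p.length ≤ t₁ ∧ q.length ≤ t₂ ∧
        r.length ≤ B * l * u ∧ x.length = 2 ^ u ∧ y.length = 2 ^ u ∧
        z.length = B * (l + 2) * u ∧ E u (lnum x) (lnum y) = lnum (z.drop (B * u)) ∧
        x ++ y = w := by
  constructor
  · rintro ⟨s, hs⟩
    obtain ⟨⟨p, x⟩, ha, hs⟩ := Option.bind_eq_some_iff.1 hs
    obtain ⟨⟨q, y⟩, hb, hs⟩ := Option.bind_eq_some_iff.1 hs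
    obtain ⟨⟨r, z⟩, hc, hs⟩ := Option.bind_eq_some_iff.1 hs
    split_ifs at hs with hcond
    simp only [Nat.unpair_pair] at hcond
    obtain ⟨h1, h2, h3, h4, h5, h6, h7⟩ := hcond
    exact ⟨p, q, r, x, y, z, (hV _ _).2 ⟨_, ha⟩, (hV _ _).2 ⟨_, hb⟩, (hV _ _).2 ⟨_, hc⟩,
      h1, h2, h3, h4, h5, h6, h7, Option.some.inj hs⟩
  · rintro ⟨p, q, r, x, y, z, hx, hy, hz, h1, h2, h3, h4, h5, h6, h7, rfl⟩
    obtain ⟨a, ha⟩ := (hV _ _).1 hx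
    obtain ⟨b, hb⟩ := (hV _ _).1 hy
    obtain ⟨c, hc⟩ := (hV _ _).1 hz
    refine ⟨Nat.pair a (Nat.pair b c), ?_⟩
    simp [badPairs, ha, hb, hc, h1, h2, h3, h4, h5, h6, h7]

theorem IsExtractor.exists_finset_pairs {B l u : ℕ} {E : ℕ → ℕ → ℕ} (hE : IsExtractor B l u E)
    (hEM : ∀ x y, E x y < 2 ^ (B * (l + 1) * u)) (hBu : 0 < B * u)
    (hu : u + B * (l + 1) * u + B * u + 2 ≤ 2 ^ u) (U : Machine) {t₁ t₂ : ℕ}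
    (ht₁ : u + B * (l + 1) * u + B * u + 2 ≤ t₁) (ht₂ : u + B * (l + 1) * u + B * u + 2 ≤ t₂) :
    ∃ S : Finset (List Bool), S.card ≤ 2 ^ (t₁ + t₂ + 5 - B * u) ∧
      ∀ p q r x y z, x ∈ U p → y ∈ U q → z ∈ U r → p.length ≤ t₁ → q.length ≤ t₂ →
        r.length ≤ B * l * u → x.length = 2 ^ u → y.length = 2 ^ u →
        E (lnum x) (lnum y) = lnum (z.drop (B * u)) → x ++ y ∈ S := by
  classical
  have hm : B * (l + 1) * u = B * l * u + B * u := by ring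
  obtain ⟨X, hX, hXm⟩ := exists_finset_outputs U t₁
  obtain ⟨Y, hY, hYm⟩ := exists_finset_outputs U t₂
  obtain ⟨Z, hZ, hZm⟩ := exists_finset_outputs U (B * l * u)
  let X' := X.filter fun x => x.length = 2 ^ u
  let Y' := Y.filter fun y => y.length = 2 ^ u
  let A := (Z.image fun z => lnum (z.drop (B * u))).filter fun v => v < 2 ^ (B * (l + 1) * u)
  have hinj : ∀ W : Finset (List Bool), Set.InjOn lnum (W.filter fun x => x.length = 2 ^ u) := by
    intro W x hx y hy hxy
    exact lnum_injOn ((Finset.mem_filter.1 hx).2.trans (Finset.mem_filter.1 hy).2.symm) hxy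
  have hsub : ∀ W : Finset (List Bool),
      (W.filter fun x => x.length = 2 ^ u).image lnum ⊆ Finset.range (2 ^ 2 ^ u) := by
    intro W v hv
    obtain ⟨x, hx, rfl⟩ := Finset.mem_image.1 hv
    rw [Finset.mem_range, ← (Finset.mem_filter.1 hx).2]
    exact lnum_lt x
  unfold IsExtractor at hE
  generalize hk : u + B * (l + 1) * u + B * u + 2 = k at *
  have hcard : ∀ (W : Finset (List Bool)) (t : ℕ), k ≤ t → W.card ≤ 2 ^ (t + 1) →
      ((W.filter fun x => x.length = 2 ^ u).image lnum).card ≤ 2 ^ k * 2 ^ (t + 1 - k) := by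
    intro W t ht hW
    rw [← pow_add, Nat.add_sub_cancel' (by omega)]
    exact Finset.card_image_le.trans ((Finset.card_filter_le _ _).trans hW)
  have hcount := hE.sum_le (Nat.pow_le_pow_right (by norm_num) hu)
    (Nat.pow_le_pow_right (by norm_num) (by omega)) (hsub X) (hsub Y)
    (a := A) (fun v hv => Finset.mem_range.2 (Finset.mem_filter.1 hv).2)
    (hcard X t₁ ht₁ hX) (hcard Y t₂ ht₂ hY)
    ((Finset.card_filter_le _ _).trans (Finset.card_image_le.trans hZ))
  rw [Finset.sum_image (hinj X)] at hcount
  simp_rw [Finset.sum_image (hinj Y)] at hcount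
  rw [← Finset.sum_product', ← Finset.card_filter, ← pow_add, ← pow_add] at hcount
  refine ⟨((X' ×ˢ Y').filter fun q => E (lnum q.1) (lnum q.2) ∈ A).image fun q => q.1 ++ q.2,
    Finset.card_image_le.trans (hcount.trans (Nat.pow_le_pow_right (by norm_num) (by omega))), ?_⟩
  intro p q r x y z hx hy hz hp hq hr hxl hyl hxyz
  refine Finset.mem_image.2 ⟨(x, y), ?_, rfl⟩
  refine Finset.mem_filter.2 ⟨Finset.mem_product.2 ⟨Finset.mem_filter.2 ⟨hXm p x hp hx, hxl⟩,
    Finset.mem_filter.2 ⟨hYm q y hq hy, hyl⟩⟩, Finset.mem_filter.2 ⟨?_, hEM _ _⟩⟩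
  exact Finset.mem_image.2 ⟨z, hZm r z hr hz, hxyz.symm⟩

theorem IsUniversalMachine.exists_plainK_append_le {U : Machine} (hU : IsUniversalMachine U)
    {B l : ℕ} {E : ℕ → ℕ → ℕ → ℕ} (hE : Computable fun q : ℕ × ℕ × ℕ => E q.1 q.2.1 q.2.2)
    (hEM : ∀ u x y, E u x y < 2 ^ (B * (l + 1) * u)) (hEx : ∀ u, IsExtractor B l u (E u)) :
    ∃ d, ∀ (u k : ℕ) (x y z : List Bool), 0 < B * u →
      u + B * (l + 1) * u + B * u + 2 ≤ 2 ^ u →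
      u + B * (l + 1) * u + B * u + 2 ≤ plainK U x →
      u + B * (l + 1) * u + B * u + 2 ≤ plainK U y →
      plainK U z ≤ B * l * u →
      x.length = 2 ^ u → y.length = 2 ^ u → z.length = B * (l + 2) * u →
      E u (lnum x) (lnum y) = lnum (z.drop (B * u)) →
      Nat.pair u (Nat.pair (plainK U x) (plainK U y)) < 2 ^ k →
      plainK U (x ++ y) + B * u ≤ plainK U x + plainK U y + 2 * k + d := by
  obtain ⟨V, hV, hVU⟩ := exists_graph_enumeration hU.1
  obtain ⟨d, hd⟩ := hU.exists_plainK_le_of_enumeration (computable₂_badPairs hV hE B l)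
  refine ⟨d + 5, fun u k x y z hBu hu hx hy hz hxl hyl hzl hxyz hk => ?_⟩
  obtain ⟨S, hS, hSm⟩ := (hEx u).exists_finset_pairs (hEM u) hBu hu U hx hy
  obtain ⟨p, hp, hpl⟩ := hU.exists_program x
  obtain ⟨q, hq, hql⟩ := hU.exists_program y
  obtain ⟨r, hr, hrl⟩ := hU.exists_program z
  obtain ⟨s, hs⟩ := (badPairs_eq_some hVU (E := E) (B := B) (l := l) (u := u)
    (t₁ := plainK U x) (t₂ := plainK U y)).2 ⟨p, q, r, x, y, z, hp, hq, hr, hpl, hql,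
      hrl.trans hz, hxl, hyl, hzl, hxyz, rfl⟩
  have := hd _ k _ S hk hS (fun s w hw => by
    obtain ⟨p, q, r, x, y, z, h1, h2, h3, h4, h5, h6, h7, h8, -, h9, rfl⟩ :=
      (badPairs_eq_some hVU).1 ⟨s, hw⟩
    exact hSm p q r x y z h1 h2 h3 h4 h5 h6 h7 h8 h9) s _ hs
  omega

theorem sq_le_two_pow {u : ℕ} (hu : 4 ≤ u) : u * u ≤ 2 ^ u := by
  induction u, hu using Nat.le_induction with
  | base => norm_num
  | succ u hu ih => rw [pow_succ]; nlinarith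

theorem linear_le_two_pow {a u : ℕ} (hu : a + 4 ≤ u) : a * u + 2 ≤ 2 ^ u := by
  have h1 := sq_le_two_pow (show 4 ≤ u by omega)
  have h2 : (a + 4) * u ≤ u * u := Nat.mul_le_mul_right _ hu
  rw [add_mul] at h2
  omega

theorem pair_pair_lt_two_pow {u t₁ t₂ : ℕ} (h₁ : t₁ ≤ 2 ^ (u + 1)) (h₂ : t₂ ≤ 2 ^ (u + 1)) :
    Nat.pair u (Nat.pair t₁ t₂) < 2 ^ (4 * u + 8) := by
  have h3 : 1 ≤ 2 ^ (u + 1) := Nat.one_le_two_pow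
  have h4 : Nat.pair t₁ t₂ < 2 ^ (2 * u + 4) := by
    refine (Nat.pair_lt_max_add_one_sq t₁ t₂).trans_le ?_
    calc (max t₁ t₂ + 1) ^ 2 ≤ (2 ^ (u + 2)) ^ 2 := by
          refine Nat.pow_le_pow_left ?_ 2
          have : max t₁ t₂ ≤ 2 ^ (u + 1) := max_le h₁ h₂
          rw [pow_succ 2 (u + 1)]
          omega
      _ = 2 ^ (2 * u + 4) := by rw [← pow_mul]; ring
  have h5 : u < 2 ^ (2 * u + 4) :=
    Nat.lt_two_pow_self.trans_le (Nat.pow_le_pow_right (by norm_num) (by omega))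
  refine (Nat.pair_lt_max_add_one_sq _ _).trans_le ?_
  calc (max u (Nat.pair t₁ t₂) + 1) ^ 2 ≤ (2 ^ (2 * u + 4)) ^ 2 :=
        Nat.pow_le_pow_left (Nat.succ_le_of_lt (max_lt h5 h4)) 2
    _ = 2 ^ (4 * u + 8) := by rw [← pow_mul]; ring

theorem logb_two_pow_natCast (u : ℕ) : Real.logb 2 ((2 ^ u : ℕ) : ℝ) = u := by
  push_cast
  rw [Real.logb_pow, Real.logb_self_eq_one (by norm_num), mul_one]

theorem IsUniversalMachine.eventually_lt_plainK {U : Machine} (hU : IsUniversalMachine U)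
    {B l : ℕ} {c : ℝ} (hB : 2 * c + 9 ≤ B) (hB0 : 0 < B) {E : ℕ → ℕ → ℕ → ℕ}
    (hE : Computable fun q : ℕ × ℕ × ℕ => E q.1 q.2.1 q.2.2)
    (hEM : ∀ u x y, E u x y < 2 ^ (B * (l + 1) * u)) (hEx : ∀ u, IsExtractor B l u (E u))
    {x y : BinSeq} (hxy : IndependentWith U c x y)
    (hx : ∀ᶠ n : ℕ in atTop,
      ((B * (l + 1) + B + 3 : ℕ) : ℝ) * Real.logb 2 n < (plainK U (initSeg x n) : ℝ))
    (hy : ∀ᶠ n : ℕ in atTop,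
      ((B * (l + 1) + B + 3 : ℕ) : ℝ) * Real.logb 2 n < (plainK U (initSeg y n) : ℝ)) :
    ∀ᶠ u : ℕ in atTop, ∀ z : List Bool, z.length = B * (l + 2) * u →
      E u (lnum (initSeg x (2 ^ u))) (lnum (initSeg y (2 ^ u))) = lnum (z.drop (B * u)) →
      B * l * u < plainK U z := by
  obtain ⟨c₀, hc₀⟩ := hU.exists_plainK_le_length
  obtain ⟨d, hd⟩ := hU.exists_plainK_append_le hE hEM hEx
  obtain ⟨d', hd'⟩ := hxy
  have hpow : Tendsto (fun u : ℕ => 2 ^ u) atTop atTop :=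
    tendsto_pow_atTop_atTop_of_one_lt (by norm_num)
  filter_upwards [hpow.eventually hx, hpow.eventually hy,
    eventually_ge_atTop (B * (l + 1) + B + 5), eventually_ge_atTop c₀,
    (tendsto_natCast_atTop_atTop (R := ℝ)).eventually_gt_atTop (16 + d + d')]
    with u hxu hyu hu1 hu2 hu3 z hz hEz
  by_contra! hcon
  rw [logb_two_pow_natCast] at hxu hyu
  have hu0 : 1 ≤ u := by omega
  have hc₀u : c₀ ≤ 2 ^ u := hu2.trans Nat.lt_two_pow_self.le
  have hle : u + B * (l + 1) * u + B * u + 2 ≤ (B * (l + 1) + B + 3) * u := by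
    have : (B * (l + 1) + B + 3) * u = u + B * (l + 1) * u + B * u + 2 * u := by ring
    omega
  have htx : u + B * (l + 1) * u + B * u + 2 ≤ plainK U (initSeg x (2 ^ u)) := by
    have : (B * (l + 1) + B + 3) * u < plainK U (initSeg x (2 ^ u)) := by exact_mod_cast hxu
    omega
  have hty : u + B * (l + 1) * u + B * u + 2 ≤ plainK U (initSeg y (2 ^ u)) := by
    have : (B * (l + 1) + B + 3) * u < plainK U (initSeg y (2 ^ u)) := by exact_mod_cast hyu
    omega
  have hu2u : u + B * (l + 1) * u + B * u + 2 ≤ 2 ^ u := by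
    have := linear_le_two_pow (a := B * (l + 1) + B + 1) (u := u) (by omega)
    have h2 : (B * (l + 1) + B + 1) * u = u + B * (l + 1) * u + B * u := by ring
    omega
  have hlen : ∀ w : BinSeq, plainK U (initSeg w (2 ^ u)) ≤ 2 ^ (u + 1) := by
    intro w
    have := hc₀ (initSeg w (2 ^ u))
    rw [length_initSeg] at this
    rw [pow_succ]
    omega
  have key := hd u (4 * u + 8) _ _ z (Nat.mul_pos hB0 hu0) hu2u htx hty hcon
    (length_initSeg _ _) (length_initSeg _ _) hz hEz (pair_pair_lt_two_pow (hlen x) (hlen y))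
  have hind := hd' (2 ^ u) (2 ^ u) Nat.one_le_two_pow Nat.one_le_two_pow
  rw [logb_two_pow_natCast] at hind
  have key' : (plainK U (initSeg x (2 ^ u) ++ initSeg y (2 ^ u)) : ℝ) + B * u
      ≤ plainK U (initSeg x (2 ^ u)) + plainK U (initSeg y (2 ^ u)) + 2 * (4 * u + 8) + d := by
    exact_mod_cast key
  have hBu : (2 * c + 9) * (u : ℝ) ≤ B * u := mul_le_mul_of_nonneg_right hB (Nat.cast_nonneg u)
  linarith

theorem exists_computable_blockIndex {b L : ℕ} (hb : 0 < b) (hL : 2 ≤ L) :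
    ∃ i : ℕ → ℕ, Computable i ∧ ∀ j p, b * L ^ j ≤ p * L → p < b * L ^ j → i p = j := by
  have hR : PrimrecRel fun p i : ℕ => p < b * L ^ i :=
    Primrec.nat_lt.comp .fst (Primrec.nat_mul.comp (Primrec.const b)
      (Primrec.nat_pow.comp (Primrec.const L) .snd))
  have hex : ∀ p : ℕ, ∃ i, p < b * L ^ i := fun p => ⟨p, calc
    p < 2 ^ p := Nat.lt_two_pow_self
    _ ≤ L ^ p := Nat.pow_le_pow_left hL p
    _ ≤ b * L ^ p := Nat.le_mul_of_pos_left _ hb⟩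
  obtain ⟨i, hi, hspec⟩ := exists_computable_of_primrecRel hR hex
  refine ⟨i, hi, fun j p hjp hpj => le_antisymm ?_ ?_⟩
  · by_contra! h
    exact (hspec p).2 j h hpj
  · by_contra! h
    have h1 : p * L < b * L ^ i p * L := Nat.mul_lt_mul_of_pos_right (hspec p).1 (by omega)
    have h2 : b * L ^ i p * L ≤ b * L ^ j := by
      rw [mul_assoc, ← pow_succ]
      exact Nat.mul_le_mul_left _ (Nat.pow_le_pow_right (by omega) h)
    omega

theorem computablePred_exists_ge_eq_mul_pow {b L : ℕ} (hb : 0 < b) (hL : 2 ≤ L) (i₀ : ℕ) :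
    ComputablePred fun n : ℕ => n ∈ {n | ∃ i ≥ i₀, n = b * L ^ i} := by
  have h1 : PrimrecPred fun n : ℕ => ∃ i < n, i₀ ≤ i ∧ n = b * L ^ i :=
    PrimrecPred.exists_lt_of (R := fun n i => i₀ ≤ i ∧ n = b * L ^ i)
      ((Primrec.nat_le.comp (Primrec.const i₀) .snd).and (Primrec.eq.comp .fst
        (Primrec.nat_mul.comp (Primrec.const b)
          (Primrec.nat_pow.comp (Primrec.const L) .snd)))) Primrec.id
  have h2 := h1.of_eq (q := fun n : ℕ => n ∈ {n | ∃ i ≥ i₀, n = b * L ^ i}) fun n => by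
    constructor
    · rintro ⟨i, -, hi, hn⟩
      exact ⟨i, hi, hn⟩
    · rintro ⟨i, hi, rfl⟩
      refine ⟨i, ?_, hi, rfl⟩
      calc i < 2 ^ i := Nat.lt_two_pow_self
        _ ≤ L ^ i := Nat.pow_le_pow_left hL i
        _ ≤ b * L ^ i := Nat.le_mul_of_pos_left _ hb
  classical
  exact ⟨inferInstance, h2.decide.to_comp⟩

theorem infinite_exists_ge_eq_mul_pow {b L : ℕ} (hb : 0 < b) (hL : 2 ≤ L) (i₀ : ℕ) :
    {n | ∃ i ≥ i₀, n = b * L ^ i}.Infinite := by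
  refine Set.infinite_of_not_bddAbove ?_
  rintro ⟨m, hm⟩
  have h1 : b * L ^ (i₀ + m) ≤ m := hm ⟨i₀ + m, by omega, rfl⟩
  have h2 : i₀ + m < b * L ^ (i₀ + m) := calc
    i₀ + m < 2 ^ (i₀ + m) := Nat.lt_two_pow_self
    _ ≤ L ^ (i₀ + m) := Nat.pow_le_pow_left hL _
    _ ≤ b * L ^ (i₀ + m) := Nat.le_mul_of_pos_left _ hb
  omega

/-- The sequence whose `i`-th block, at the positions from `B * L ^ i` to `B * L ^ (i + 1)`, holds the
bits of the `L ^ i`-th colouring at the initial segments of `x` and `y` of length `2 ^ L ^ i`. -/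
def blockSeq (B L : ℕ) (E : ℕ → ℕ → ℕ → ℕ) (i : ℕ → ℕ) (x y : BinSeq) : BinSeq := fun p =>
  (E (L ^ i p) (lnum (initSeg x (2 ^ L ^ i p))) (lnum (initSeg y (2 ^ L ^ i p)))).testBit
    (p - B * L ^ i p)

theorem isTruthTableReduction_blockSeq (B L : ℕ) {E : ℕ → ℕ → ℕ → ℕ}
    (hE : Computable fun q : ℕ × ℕ × ℕ => E q.1 q.2.1 q.2.2) {i : ℕ → ℕ} (hi : Computable i) :
    IsTruthTableReduction (blockSeq B L E i) := by
  have hu : Computable fun p => L ^ i p :=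
    Primrec.nat_pow.to_comp.comp (Computable.const L) hi
  have hn : Computable fun p => 2 ^ L ^ i p :=
    Primrec.nat_pow.to_comp.comp (Computable.const 2) hu
  have hu' : Computable fun q : ℕ × ℕ × ℕ => L ^ i q.1 := hu.comp .fst
  have hE' : Computable fun q : ℕ × ℕ × ℕ => E (L ^ i q.1) q.2.1 q.2.2 := by
    have := hE.comp (Computable.pair hu' .snd)
    exact this
  have hg : Computable fun q : ℕ × ℕ × ℕ =>
      (E (L ^ i q.1) q.2.1 q.2.2).testBit (q.1 - B * L ^ i q.1) :=
    Primrec.nat_testBit.to_comp.comp hE' (Primrec.nat_sub.to_comp.comp .fst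
      (Primrec.nat_mul.to_comp.comp (Computable.const B) hu'))
  exact isTruthTableReduction_of_initSeg hg hn

theorem lnum_drop_initSeg_blockSeq {B l : ℕ} {E : ℕ → ℕ → ℕ → ℕ} {i : ℕ → ℕ}
    (hEM : ∀ u x y, E u x y < 2 ^ (B * (l + 1) * u))
    (hi : ∀ j p, B * (l + 2) * (l + 2) ^ j ≤ p * (l + 2) → p < B * (l + 2) * (l + 2) ^ j → i p = j)
    (x y : BinSeq) (j : ℕ) :
    E ((l + 2) ^ j) (lnum (initSeg x (2 ^ (l + 2) ^ j))) (lnum (initSeg y (2 ^ (l + 2) ^ j)))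
      = lnum ((initSeg (blockSeq B (l + 2) E i x y) (B * (l + 2) * (l + 2) ^ j)).drop
          (B * (l + 2) ^ j)) := by
  set u := (l + 2) ^ j with hu
  set v := E u (lnum (initSeg x (2 ^ u))) (lnum (initSeg y (2 ^ u))) with hv
  have hlen : B * (l + 2) * u = B * u + B * (l + 1) * u := by ring
  have hvM : v < 2 ^ (B * (l + 1) * u) := hEM _ _ _
  refine (lnum_initSeg_testBit hvM).symm.trans ?_
  congr 1
  refine List.ext_getElem ?_ fun m h1 h2 => ?_
  · simp [hlen]
  · rw [length_initSeg] at h1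
    have him : i (B * u + m) = j := by
      refine hi j _ ?_ ?_
      · rw [← hu]; nlinarith
      · rw [← hu, hlen]; omega
    simp [initSeg, blockSeq, him, ← hu, v]

theorem mainTheorem4 (U : Machine) (hU : IsUniversalMachine U) (δ : ℝ) (hδ : 0 < δ) (c : ℝ) :
    ∃ (C : ℝ) (f : BinSeq → BinSeq → BinSeq), IsTruthTableReduction f ∧
      ∀ x y : BinSeq, IndependentWith U c x y →
        (∀ᶠ n : ℕ in atTop, C * Real.logb 2 n < (plainK U (initSeg x n) : ℝ)) →
        (∀ᶠ n : ℕ in atTop, C * Real.logb 2 n < (plainK U (initSeg y n) : ℝ)) →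
        (∃ᶠ n : ℕ in atTop, (1 - δ) * (n : ℝ) < (plainK U (initSeg (f x y) n) : ℝ)) ∧
        ∃ S : Set ℕ, S.Infinite ∧ ComputablePred (fun n : ℕ => n ∈ S) ∧
          ∀ n ∈ S, (1 - δ) * (n : ℝ) < (plainK U (initSeg (f x y) n) : ℝ) := by
  obtain ⟨l, hl⟩ := exists_nat_ge (2 / δ)
  have hl' : 2 ≤ δ * (l + 2) := by
    rw [div_le_iff₀ hδ] at hl
    nlinarith
  obtain ⟨B₀, hB₀⟩ := exists_nat_ge (2 * c + 9)
  let B := B₀ + 1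
  have hB : 2 * c + 9 ≤ (B : ℝ) := by simp only [B]; push_cast; linarith
  have hB0 : 0 < B := Nat.succ_pos _
  have hL : 2 ≤ l + 2 := by omega
  have hb : 0 < B * (l + 2) := Nat.mul_pos hB0 (by omega)
  obtain ⟨E, hE, hEs⟩ := exists_computable_isExtractor hB0 l
  have hEM := fun u => (hEs u).1
  obtain ⟨i, hic, hi⟩ := exists_computable_blockIndex hb hL
  refine ⟨((B * (l + 1) + B + 3 : ℕ) : ℝ), blockSeq B (l + 2) E i,
    isTruthTableReduction_blockSeq B (l + 2) hE hic, fun x y hxy hx hy => ?_⟩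
  have hev := hU.eventually_lt_plainK hB hB0 hE hEM (fun u => (hEs u).2) hxy hx hy
  have hpow : Tendsto (fun j : ℕ => (l + 2) ^ j) atTop atTop :=
    tendsto_pow_atTop_atTop_of_one_lt (by omega)
  obtain ⟨i₀, hi₀⟩ := eventually_atTop.1 (hpow.eventually hev)
  have hS : ∀ n ∈ {n | ∃ j ≥ i₀, n = B * (l + 2) * (l + 2) ^ j},
      (1 - δ) * (n : ℝ) < (plainK U (initSeg (blockSeq B (l + 2) E i x y) n) : ℝ) := by
    rintro n ⟨j, hj, rfl⟩
    have h1 := hi₀ j hj _ (length_initSeg _ _) (lnum_drop_initSeg_blockSeq hEM hi x y j)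
    have h2 : ((B * l * (l + 2) ^ j : ℕ) : ℝ)
        < plainK U (initSeg (blockSeq B (l + 2) E i x y) (B * (l + 2) * (l + 2) ^ j)) := by
      exact_mod_cast h1
    refine lt_of_le_of_lt ?_ h2
    push_cast
    have h3 : (0 : ℝ) ≤ B * (l + 2) ^ j := by positivity
    nlinarith [mul_le_mul_of_nonneg_right hl' h3]
  refine ⟨?_, _, infinite_exists_ge_eq_mul_pow hb hL i₀,
    computablePred_exists_ge_eq_mul_pow hb hL i₀, hS⟩
  exact (Nat.frequently_atTop_iff_infinite.2 (infinite_exists_ge_eq_mul_pow hb hL i₀)).mono hS
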